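/- Let $\gamma=(1+\sqrt2)^2$ and, for $s>0$, $D_s=\{z\in\mathbb C:|z|<s\}$. Let $T\colon I\to I$, $I=[-1,1]$, be an analytic full branch map: $I=\bigcup_{\ell=1}^d I_\ell$ with closed intervals $I_\ell$ with disjoint interiors, and each $T|_{\operatorname{int}(I_\ell)}$ is an analytic diffeomorphism onto its image with $\overline{T(I_\ell)}=I$. Assume that for some $1<r<R$ the inverse branches $\varphi_\ell\colon I\to I_\ell$ extend to bounded holomorphic functions on $D_R$ with $\bigcup_\ell\varphi_\ell(D_R)\subseteq D_r$, and that $r/R<1/\gamma$. Put $\rho=\sqrt{rR/\gamma}\in(r,R)$. Let $(\mathcal Lf)(z)=\sum_{\ell=1}^d\sigma_\ell\,\varphi_\ell'(z)f(\varphi_\ell(z))$ with $\sigma_\ell=\operatorname{sgn}\varphi_\ell'(0)$, let $e_n(z)=(z/\rho)^n$ for $n\in\mathbb N_0$, let $(f,g)=\lim_{s\uparrow\rho}\frac1{2\pi}\int_0^{2\pi}f(se^{it})\overline{g(se^{it})}\,dt$ be the inner product of the Hardy space $H^2(D_\rho)$, and let $L$ be the matrix representation of $\mathcal L$ on $H^2(D_\rho)$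 in the orthonormal basis $(e_n)$, that is, the bounded operator on $\ell^2(\mathbb N_0)$ with matrix entries $L_{k\ell}=(\mathcal Le_\ell,e_k)$. For $M\in\mathbb N$, $0\le\delta\le 2/M$ and $x_m=-1+\delta+2m/M$ $(0\le m<M)$, consider the $N\times N$ matrices $$(\hat H_N^{(M)})_{k\ell}=\frac1M\sum_{m=0}^{M-1}x_m^kx_m^\ell,\qquad (\hat G_N^{(M)})_{k\ell}=\frac1M\sum_{m=0}^{M-1}T(x_m)^kx_m^\ell,\qquad 0\le k,\ell\le N-1.$$ Identify an $N\times N$ matrix with the operator on $\ell^2(\mathbb N_0)$ that acts by it on the first $N$ coordinates and is zero on the others. In this sense let $G_N^{(M)}$, $V_N$, $V_N^{-1}$ be the operators given by $\hat G_N^{(M)}$, $\operatorname{diag}(\rho^n)_{n<N}$, $\operatorname{diag}(\rho^{-n})_{n<N}$, and, when $\hat H_N^{(M)}$ is invertible, let $(H_N^{(M)})^\dagger$ be the operator given by $(\hat H_N^{(M)})^{-1}$. Then there is a constant $C>0$ such that for all $N\in\mathbb N_0$, all $M\in\mathbb N$ with $M\ge N^2R^N$ and all $0\le\delta\le 2/M$,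 the matrix $\hat H_N^{(M)}$ is invertible and $$\big\|V_N(H_N^{(M)})^\dagger G_N^{(M)}V_N^{-1}-L\big\|_{\ell^2\to\ell^2}\le C\Big(\frac{\gamma r}{R}\Big)^{N/2}.$$ -/

import Mathlib

open Set Filter Topology

/-- The constant `γ = (1 + √2)²`. -/
noncomputable def edmdGamma : ℝ := (1 + Real.sqrt 2) ^ 2

/-- `T` is an analytic full branch map of `[-1, 1]` with `d` branches, living on the closed
intervals `I_l = [a l, b l]`.  On the interior of each `I_l` the map is an analytic
diffeomorphism onto its image; this image is an open subinterval of `[-1, 1]`, and it is dense in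
`[-1, 1]` exactly when it equals `(-1, 1)`.  Nothing but `T x ∈ [-1, 1]` is asked at the
endpoints of the `I_l`. -/
structure IsAnalyticFullBranchMap {d : ℕ} (T : ℝ → ℝ) (a b : Fin d → ℝ) : Prop where
  mapsTo : MapsTo T (Icc (-1) 1) (Icc (-1) 1)
  iUnion_eq : ⋃ l, Icc (a l) (b l) = Icc (-1 : ℝ) 1
  disjoint : Pairwise fun l l' => Disjoint (Ioo (a l) (b l)) (Ioo (a l') (b l'))
  analytic : ∀ l, AnalyticOnNhd ℝ T (Ioo (a l) (b l))
  deriv_ne_zero : ∀ l, ∀ x ∈ Ioo (a l) (b l), deriv T x ≠ 0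
  bijOn : ∀ l, BijOn T (Ioo (a l) (b l)) (Ioo (-1) 1)

/-- The functions `φ l` are holomorphic extensions to the disk `D_R` of the inverse branches of
`T`, they map `D_R` into `D_r` (so in particular they are bounded on `D_R`), and `1 < r < R`. -/
structure HasAnalyticInverseBranches {d : ℕ} (T : ℝ → ℝ) (a b : Fin d → ℝ)
    (φ : Fin d → ℂ → ℂ) (r R : ℝ) : Prop where
  one_lt : 1 < r
  lt : r < R
  differentiableOn : ∀ l, DifferentiableOn ℂ (φ l) (Metric.ball 0 R)
  inverse : ∀ l, ∀ x ∈ Ioo (a l) (b l), φ l ((T x : ℝ) : ℂ) = ((x : ℝ) : ℂ)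
  mapsTo : ∀ l, MapsTo (φ l) (Metric.ball 0 R) (Metric.ball 0 r)

/-- The transfer operator `(𝓛 f)(z) = ∑ l, σ l * (φ l)'(z) * f (φ l z)` with
`σ l = sgn ((φ l)'(0))`; the number `(φ l)'(0)` is real. -/
noncomputable def transferOp {d : ℕ} (φ : Fin d → ℂ → ℂ) (f : ℂ → ℂ) (z : ℂ) : ℂ :=
  ∑ l, ((Real.sign (deriv (φ l) 0).re : ℝ) : ℂ) * deriv (φ l) z * f (φ l z)

/-- The orthonormal basis `e_n(z) = (z / ρ)^n` of the Hardy space `H²(D_ρ)`. -/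
noncomputable def hardyBasis (ρ : ℝ) (n : ℕ) (z : ℂ) : ℂ := (z / (ρ : ℂ)) ^ n

/-- The inner product of `H²(D_ρ)`: the limit
`(f, g) = lim_{s ↑ ρ} (1 / 2π) ∫_0^{2π} f(s e^{it}) conj (g(s e^{it})) dt` exists and equals
`c`. -/
def HasHardyInner (ρ : ℝ) (f g : ℂ → ℂ) (c : ℂ) : Prop :=
  Tendsto (fun s : ℝ => (1 / (2 * (Real.pi : ℂ))) *
      ∫ t in (0 : ℝ)..(2 * Real.pi), f (circleMap 0 s t) * star (g (circleMap 0 s t)))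
    (𝓝[<] ρ) (𝓝 c)

/-- The Hilbert space `ℓ²(ℕ₀)` over `ℂ`. -/
abbrev EllTwo : Type := lp (fun _ : ℕ => ℂ) 2

/-- The standard unit vectors of `ℓ²(ℕ₀)`. -/
noncomputable def unitVec (n : ℕ) : EllTwo := lp.single 2 n (1 : ℂ)

/-- The bounded operator `L` on `ℓ²(ℕ₀)` has the matrix entries `L_{kl} = (𝓛 e_l, e_k)`.  The
entries determine a bounded operator. -/
def IsTransferMatrix {d : ℕ} (φ : Fin d → ℂ → ℂ) (ρ : ℝ) (L : EllTwo →L[ℂ] EllTwo) : Prop :=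
  ∀ k l : ℕ, HasHardyInner ρ (transferOp φ (hardyBasis ρ l)) (hardyBasis ρ k)
    ((L (unitVec l) : ℕ → ℂ) k)

/-- The lift of an `N × N` matrix to `ℓ²(ℕ₀)`: the operator that acts as the matrix on the first
`N` coordinates and vanishes on (and has no component in) the remaining ones. -/
noncomputable def liftOp {N : ℕ} (A : Matrix (Fin N) (Fin N) ℂ) : EllTwo →L[ℂ] EllTwo :=
  ∑ k, ∑ l, A k l • InnerProductSpace.rankOne ℂ (unitVec k) (unitVec l)

/-- `V_N = P_N V P_N`, where `V` multiplies the `n`-th coordinate by `ρ^n`. -/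
noncomputable def opV (ρ : ℝ) (N : ℕ) : EllTwo →L[ℂ] EllTwo :=
  liftOp (Matrix.diagonal fun n : Fin N => ((ρ ^ (n : ℕ) : ℝ) : ℂ))

/-- `V_N⁻¹ = P_N V⁻¹ P_N`, where `V⁻¹` multiplies the `n`-th coordinate by `ρ^{-n}`. -/
noncomputable def opVInv (ρ : ℝ) (N : ℕ) : EllTwo →L[ℂ] EllTwo :=
  liftOp (Matrix.diagonal fun n : Fin N => (((ρ ^ (n : ℕ))⁻¹ : ℝ) : ℂ))

/-- The equidistant nodes `x_m = -1 + δ + 2 m / M`. -/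
noncomputable def edmdNode (M : ℕ) (δ : ℝ) (m : ℕ) : ℝ := -1 + δ + 2 * (m : ℝ) / (M : ℝ)

/-- The `N × N` matrix with entries `(1 / M) ∑_{m < M} x_m^k x_m^l`. -/
noncomputable def edmdH (M : ℕ) (δ : ℝ) (N : ℕ) : Matrix (Fin N) (Fin N) ℂ :=
  Matrix.of fun k l => (((1 / (M : ℝ)) * ∑ m ∈ Finset.range M,
    edmdNode M δ m ^ (k : ℕ) * edmdNode M δ m ^ (l : ℕ) : ℝ) : ℂ)

/-- The `N × N` matrix with entries `(1 / M) ∑_{m < M} T(x_m)^k x_m^l`. -/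
noncomputable def edmdG (T : ℝ → ℝ) (M : ℕ) (δ : ℝ) (N : ℕ) : Matrix (Fin N) (Fin N) ℂ :=
  Matrix.of fun k l => (((1 / (M : ℝ)) * ∑ m ∈ Finset.range M,
    T (edmdNode M δ m) ^ (k : ℕ) * edmdNode M δ m ^ (l : ℕ) : ℝ) : ℂ)

/-!
The matrix entries of the transfer operator in the basis `e_n` are `ρ^k τ_{kl} ρ^{-l}`, where
`τ_{kl}` is the `k`-th Taylor coefficient of `𝓛 z^l`.  Fix a radius `s` with `ρ < s < R`.  As the
inverse branches map into the disk of radius `r`, Cauchy's estimate gives `|τ_{kl}| ≤ K r^l s^{-k}`,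
so the entries are bounded by `K (ρ/s)^k (r/ρ)^l` and are absolutely summable.  This defines the
limit operator `L` as a norm convergent sum of rank-one operators, and reduces the claim to estimates
of the matrix entries, since each of these rank-one operators has norm one.  The entries of `L`
outside the leading `N × N` block contribute `O(q^N)` with
`q = r / ρ = γ ρ / R = (γ r / R)^{1/2}`.

Inside the block, the `l`-th column of `H⁻¹ G` is compared with `τ_{·l}` by a combination
of consistency and stability.

* Consistency (`exists_consistency_const`): the residual `G_{·l} - H τ_{·l}` is `O(r^l s^{-N})`.
  With exact integrals in place of Riemann sums, the change of variables `x = φ_l(y)` on each branch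
  turns `½ ∫ T^k x^l` into `½ ∫ y^k 𝓛 z^l`, and the residual is the integral of a Taylor remainder.
  The quadrature errors are `O(N / M)`, because `T` has bounded variation, and this is `O(s^{-N})`
  for `M ≥ N² R^N`.

* Stability (`exists_stability_const`): `∑ |c_k| ρ^k ≤ K Λ^N max |(H c)_k|` with
  `Λ = (1 + √2) (ρ + √(1 + ρ²))`.  Expanding a polynomial in Chebyshev polynomials of the second kind,
  which are orthogonal for a weight that is at most one, bounds `∑ |c_k| s^k` for `s ≥ 1` by
  `2 (s + √(1 + s²))^N` times the `L²` norm on `[-1, 1]` (`sum_norm_coeff_le`).  The square of this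
  norm is in turn bounded by twice the quadratic form of `H` as soon as `M` is at least
  `32 N γ^N`; the finitely many remaining pairs `(N, M)` are covered by compactness in the offset `δ`.

As `ρ > 1`, the factor `Λ` is strictly less than `γ ρ`, so `s < R` can be chosen with `Λ / s = q`
exactly (`exists_radius`).  Stability and consistency then bound the error of the `l`-th column by a
constant times `q^N (r / ρ)^l`, which is summable in `l`.
-/

/-! ### Chebyshev expansions and coefficients of polynomials -/

open Polynomial in
/-- The absolute coefficients of `U_n` obey the recursion of the Chebyshev polynomials with both
signs positive, whose characteristic root is `s + √(1 + s²)`. -/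
theorem sum_norm_coeff_U_le {s : ℝ} (hs : 0 ≤ s) (N n : ℕ) :
    ∑ k ∈ Finset.range N, ‖(Chebyshev.U ℂ (n : ℤ)).coeff k‖ * s ^ k
      ≤ (s + Real.sqrt (1 + s ^ 2)) ^ n := by
  set t : ℝ := s + Real.sqrt (1 + s ^ 2) with ht
  have hsq : Real.sqrt (1 + s ^ 2) ^ 2 = 1 + s ^ 2 := Real.sq_sqrt (by positivity)
  have hle : s ≤ Real.sqrt (1 + s ^ 2) := Real.le_sqrt_of_sq_le (by linarith)
  have ht2 : t ^ 2 = 2 * s * t + 1 := by rw [ht]; ring_nf; rw [hsq]; ring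
  have ht0 : 0 ≤ t := by positivity
  have hX : ∀ (p : ℂ[X]) (N : ℕ), ∑ k ∈ Finset.range N, ‖(2 * X * p).coeff k‖ * s ^ k
      ≤ 2 * s * ∑ k ∈ Finset.range N, ‖p.coeff k‖ * s ^ k := by
    intro p N
    cases N with
    | zero => simp
    | succ N =>
      rw [Finset.sum_range_succ']
      have h0 : (2 * X * p).coeff 0 = 0 := by simp
      have h1 : ∀ k, (2 * X * p).coeff (k + 1) = 2 * p.coeff k := by
        intro k
        rw [mul_assoc, show (2 : ℂ[X]) = C 2 from (map_ofNat C 2).symm, coeff_C_mul, coeff_X_mul]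
      rw [h0, Finset.sum_range_succ, mul_add, Finset.mul_sum]
      simp only [h1, norm_zero, zero_mul, add_zero, norm_mul]
      have : ∀ k, ‖(2 : ℂ)‖ * ‖p.coeff k‖ * s ^ (k + 1) = 2 * s * (‖p.coeff k‖ * s ^ k) := by
        intro k; simp; ring
      simp only [this]
      have : 0 ≤ 2 * s * (‖p.coeff N‖ * s ^ N) := by positivity
      linarith
  induction n using Nat.strong_induction_on with
  | _ n ih =>
    match n with
    | 0 =>
      have : ∀ k ∈ Finset.range N, ‖(Chebyshev.U ℂ ((0 : ℕ) : ℤ)).coeff k‖ * s ^ k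
          = if k = 0 then 1 else 0 := by
        intro k _
        by_cases hk : k = 0 <;> simp [hk, coeff_one]
      rw [Finset.sum_congr rfl this, Finset.sum_ite_eq']
      split_ifs <;> simp
    | 1 =>
      have h := hX 1 N
      have : ∑ k ∈ Finset.range N, ‖(1 : ℂ[X]).coeff k‖ * s ^ k ≤ 1 := by
        have : ∀ k ∈ Finset.range N, ‖(1 : ℂ[X]).coeff k‖ * s ^ k = if k = 0 then 1 else 0 := by
          intro k _
          by_cases hk : k = 0 <;> simp [hk, coeff_one]
        rw [Finset.sum_congr rfl this, Finset.sum_ite_eq']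
        split_ifs <;> simp
      have h2 : 2 * s * ∑ k ∈ Finset.range N, ‖(1 : ℂ[X]).coeff k‖ * s ^ k ≤ 2 * s * 1 := by
        gcongr
      simp only [mul_one] at h h2
      simp only [Nat.cast_one, Chebyshev.U_one, pow_one]
      linarith
    | n + 2 =>
      have e : Chebyshev.U ℂ ((n + 2 : ℕ) : ℤ)
          = 2 * X * Chebyshev.U ℂ ((n + 1 : ℕ) : ℤ) - Chebyshev.U ℂ (n : ℤ) := by
        push_cast; exact Chebyshev.U_add_two ℂ n
      rw [e]
      calc _ ≤ ∑ k ∈ Finset.range N, (‖(2 * X * Chebyshev.U ℂ ((n + 1 : ℕ) : ℤ)).coeff k‖ * s ^ k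
              + ‖(Chebyshev.U ℂ (n : ℤ)).coeff k‖ * s ^ k) := by
            gcongr with k
            rw [coeff_sub, ← add_mul]
            gcongr
            exact norm_sub_le _ _
        _ ≤ 2 * s * t ^ (n + 1) + t ^ n := by
            rw [Finset.sum_add_distrib]
            gcongr
            · refine (hX _ N).trans ?_
              gcongr
              exact ih (n + 1) (by omega)
            · exact ih n (by omega)
        _ = t ^ (n + 2) := by rw [pow_add t n 2, ht2]; ring

open Polynomial in
/-- Polynomials of degree less than `N` are combinations of `U_0, …, U_{N-1}`. -/
theorem exists_eq_sum_U (N : ℕ) (p : ℂ[X]) (hp : p.degree < N) :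
    ∃ α : ℕ → ℂ, p = ∑ j ∈ Finset.range N, C (α j) * Chebyshev.U ℂ (j : ℤ) := by
  induction N generalizing p with
  | zero =>
    refine ⟨0, ?_⟩
    simpa using hp
  | succ N ih =>
    set u := Chebyshev.U ℂ (N : ℤ) with hu
    have hud : u.degree = N := Chebyshev.degree_U_natCast ℂ N
    have hul : u.coeff N ≠ 0 := by
      have := leadingCoeff_ne_zero.mpr (Chebyshev.U_ne_zero (R := ℂ) (N : ℤ) (by omega))
      rwa [leadingCoeff, Chebyshev.natDegree_U_natCast] at this
    have hq : (p - C (p.coeff N / u.coeff N) * u).degree < N := by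
      rw [degree_lt_iff_coeff_zero]
      intro m hm
      rcases hm.eq_or_lt with rfl | hm
      · simp [hul]
      · have h1 : p.coeff m = 0 := coeff_eq_zero_of_degree_lt (hp.trans_le (by exact_mod_cast hm))
        have h2 : u.coeff m = 0 := coeff_eq_zero_of_degree_lt (by rw [hud]; exact_mod_cast hm)
        simp [h1, h2]
    obtain ⟨α, hα⟩ := ih _ hq
    refine ⟨fun j => if j = N then p.coeff N / u.coeff N else α j, ?_⟩
    rw [Finset.sum_range_succ]
    simp only [if_true]
    rw [← hu, ← sub_eq_iff_eq_add, hα]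
    refine Finset.sum_congr rfl fun j hj => ?_
    rw [if_neg (Finset.mem_range.mp hj).ne]

theorem integral_sin_mul_sin (i j : ℕ) :
    ∫ θ in (0 : ℝ)..Real.pi, Real.sin ((i + 1) * θ) * Real.sin ((j + 1) * θ)
      = if i = j then Real.pi / 2 else 0 := by
  have hcos : ∀ k : ℤ, ∫ θ in (0 : ℝ)..Real.pi, Real.cos (k * θ) = if k = 0 then Real.pi else 0 := by
    intro k
    split_ifs with hk
    · simp [hk]
    · rw [intervalIntegral.integral_comp_mul_left _ (by exact_mod_cast hk)]
      simp
  have h : ∀ θ : ℝ, Real.sin ((i + 1) * θ) * Real.sin ((j + 1) * θ)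
      = (Real.cos (((i : ℤ) - j : ℤ) * θ) - Real.cos (((i : ℤ) + j + 2 : ℤ) * θ)) / 2 := by
    intro θ
    have e1 : (((i : ℤ) - j : ℤ) : ℝ) * θ = (i + 1) * θ - (j + 1) * θ := by push_cast; ring
    have e2 : (((i : ℤ) + j + 2 : ℤ) : ℝ) * θ = (i + 1) * θ + (j + 1) * θ := by push_cast; ring
    rw [e1, e2, Real.cos_sub, Real.cos_add]; ring
  simp only [h]
  rw [intervalIntegral.integral_div, intervalIntegral.integral_sub
    (by apply Continuous.intervalIntegrable; fun_prop)
    (by apply Continuous.intervalIntegrable; fun_prop), hcos, hcos,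
    if_neg (show ¬ ((i : ℤ) + j + 2 = 0) by omega)]
  by_cases hij : i = j
  · simp [hij]
  · rw [if_neg hij, if_neg (by omega)]; simp

theorem integral_sum_sin_sq (N : ℕ) (α : ℕ → ℝ) :
    ∫ θ in (0 : ℝ)..Real.pi, (∑ j ∈ Finset.range N, α j * Real.sin ((j + 1) * θ)) ^ 2
      = Real.pi / 2 * ∑ j ∈ Finset.range N, α j ^ 2 := by
  have h : ∀ θ : ℝ, (∑ j ∈ Finset.range N, α j * Real.sin ((j + 1) * θ)) ^ 2
      = ∑ i ∈ Finset.range N, ∑ j ∈ Finset.range N,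
        α i * α j * (Real.sin ((i + 1) * θ) * Real.sin ((j + 1) * θ)) := by
    intro θ
    rw [sq, Finset.sum_mul_sum]
    refine Finset.sum_congr rfl fun i _ => Finset.sum_congr rfl fun j _ => by ring
  simp only [h]
  rw [intervalIntegral.integral_finsetSum
    (fun i _ => by apply Continuous.intervalIntegrable; fun_prop), Finset.mul_sum]
  refine Finset.sum_congr rfl fun i hi => ?_
  rw [intervalIntegral.integral_finsetSum
    (fun i _ => by apply Continuous.intervalIntegrable; fun_prop)]
  simp only [intervalIntegral.integral_const_mul, integral_sin_mul_sin]
  simp only [mul_ite, mul_zero, Finset.sum_ite_eq, hi, if_true]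
  ring

open Polynomial in
/-- Bessel's inequality for the Chebyshev polynomials of the second kind, whose orthogonality
weight `√(1 - x²)` is at most `1`. -/
theorem sum_norm_sq_le_integral (N : ℕ) (α : ℕ → ℂ) :
    Real.pi / 2 * ∑ j ∈ Finset.range N, ‖α j‖ ^ 2
      ≤ ∫ x in (-1 : ℝ)..1,
        ‖(∑ j ∈ Finset.range N, C (α j) * Chebyshev.U ℂ (j : ℤ)).eval (x : ℂ)‖ ^ 2 := by
  set p := ∑ j ∈ Finset.range N, C (α j) * Chebyshev.U ℂ (j : ℤ) with hp
  have hc : Continuous fun x : ℝ => ‖p.eval (x : ℂ)‖ ^ 2 :=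
    ((p.continuous.comp Complex.continuous_ofReal).norm.pow 2)
  have hsub : ∫ x in (-1 : ℝ)..1, ‖p.eval (x : ℂ)‖ ^ 2
      = ∫ θ in (0 : ℝ)..Real.pi, ‖p.eval ((Real.cos θ : ℝ) : ℂ)‖ ^ 2 * Real.sin θ := by
    have := intervalIntegral.integral_comp_mul_deriv (a := 0) (b := Real.pi)
      (f := Real.cos) (f' := fun θ => -Real.sin θ) (g := fun x : ℝ => ‖p.eval (x : ℂ)‖ ^ 2)
      (fun x _ => Real.hasDerivAt_cos x) (by fun_prop) hc
    rw [Real.cos_zero, Real.cos_pi, intervalIntegral.integral_symm (-1) 1] at this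
    simp only [mul_neg, intervalIntegral.integral_neg, Function.comp_apply, neg_inj] at this
    exact this.symm
  rw [hsub]
  have hval : ∀ θ : ℝ, p.eval ((Real.cos θ : ℝ) : ℂ) * ((Real.sin θ : ℝ) : ℂ)
      = ∑ j ∈ Finset.range N, α j * ((Real.sin ((j + 1) * θ) : ℝ) : ℂ) := by
    intro θ
    rw [hp, eval_finsetSum, Finset.sum_mul]
    refine Finset.sum_congr rfl fun j _ => ?_
    have := Chebyshev.U_complex_cos (θ : ℂ) (j : ℤ)
    push_cast at this ⊢
    rw [← this, eval_mul, eval_C, mul_assoc]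
  have hnorm : ∀ θ : ℝ, ‖p.eval ((Real.cos θ : ℝ) : ℂ) * ((Real.sin θ : ℝ) : ℂ)‖ ^ 2
      = (∑ j ∈ Finset.range N, (α j).re * Real.sin ((j + 1) * θ)) ^ 2
        + (∑ j ∈ Finset.range N, (α j).im * Real.sin ((j + 1) * θ)) ^ 2 := by
    intro θ
    rw [hval, ← Complex.normSq_eq_norm_sq, Complex.normSq_apply, Complex.re_sum, Complex.im_sum]
    simp only [Complex.re_mul_ofReal, Complex.im_mul_ofReal]
    ring
  calc Real.pi / 2 * ∑ j ∈ Finset.range N, ‖α j‖ ^ 2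
      = ∫ θ in (0 : ℝ)..Real.pi, ‖p.eval ((Real.cos θ : ℝ) : ℂ) * ((Real.sin θ : ℝ) : ℂ)‖ ^ 2 := by
        simp only [hnorm]
        rw [intervalIntegral.integral_add (by apply Continuous.intervalIntegrable; fun_prop)
          (by apply Continuous.intervalIntegrable; fun_prop), integral_sum_sin_sq,
          integral_sum_sin_sq, ← mul_add, ← Finset.sum_add_distrib]
        congr 1
        refine Finset.sum_congr rfl fun j _ => ?_
        rw [← Complex.normSq_eq_norm_sq, Complex.normSq_apply]; ring
    _ ≤ _ := by
        have hc' : Continuous fun θ : ℝ => p.eval ((Real.cos θ : ℝ) : ℂ) :=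
          p.continuous.comp (Complex.continuous_ofReal.comp Real.continuous_cos)
        refine intervalIntegral.integral_mono_on Real.pi_pos.le
          (by apply Continuous.intervalIntegrable; fun_prop)
          (by apply Continuous.intervalIntegrable; fun_prop) fun θ hθ => ?_
        have h0 := Real.sin_nonneg_of_mem_Icc hθ
        have h1 := Real.sin_le_one θ
        rw [norm_mul, mul_pow, Complex.norm_real, Real.norm_eq_abs, sq_abs]
        gcongr
        nlinarith

open Polynomial in
/-- The weighted coefficient sum of a polynomial is controlled by its `L²` norm for the
probability measure `dx / 2` on `[-1, 1]`. -/
theorem sum_norm_coeff_le {s : ℝ} (hs : 1 ≤ s) (N : ℕ) (p : ℂ[X]) (hp : p.degree < N) :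
    ∑ k ∈ Finset.range N, ‖p.coeff k‖ * s ^ k
      ≤ 2 * (s + Real.sqrt (1 + s ^ 2)) ^ N
        * Real.sqrt (1 / 2 * ∫ x in (-1 : ℝ)..1, ‖p.eval (x : ℂ)‖ ^ 2) := by
  obtain ⟨α, rfl⟩ := exists_eq_sum_U N p hp
  have hB := sum_norm_sq_le_integral N α
  set I := ∫ x in (-1 : ℝ)..1,
        ‖(∑ j ∈ Finset.range N, C (α j) * Chebyshev.U ℂ (j : ℤ)).eval (x : ℂ)‖ ^ 2
  set t : ℝ := s + Real.sqrt (1 + s ^ 2) with ht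
  have hs0 : 0 ≤ s := by linarith
  have hle : s ≤ Real.sqrt (1 + s ^ 2) := Real.le_sqrt_of_sq_le (by linarith)
  have ht2 : 2 ≤ t := by linarith
  have h1 : ∑ k ∈ Finset.range N,
      ‖(∑ j ∈ Finset.range N, C (α j) * Chebyshev.U ℂ (j : ℤ)).coeff k‖ * s ^ k
      ≤ ∑ j ∈ Finset.range N, ‖α j‖ * t ^ j := by
    calc _ ≤ ∑ k ∈ Finset.range N, ∑ j ∈ Finset.range N,
            ‖α j‖ * (‖(Chebyshev.U ℂ (j : ℤ)).coeff k‖ * s ^ k) := by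
          gcongr with k hk
          rw [finsetSum_coeff]
          refine (mul_le_mul_of_nonneg_right (norm_sum_le _ _) (by positivity)).trans ?_
          rw [Finset.sum_mul]
          refine Finset.sum_le_sum fun j _ => ?_
          rw [coeff_C_mul, norm_mul, mul_assoc]
      _ ≤ _ := by
          rw [Finset.sum_comm]
          gcongr with j hj
          rw [← Finset.mul_sum]
          gcongr
          exact sum_norm_coeff_U_le hs0 N j
  refine h1.trans ?_
  have h2 := Finset.sum_mul_sq_le_sq_mul_sq (Finset.range N) (fun j => ‖α j‖) (fun j => t ^ j)
  have h3 : ∑ j ∈ Finset.range N, (t ^ j) ^ 2 ≤ (t ^ N) ^ 2 := by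
    have : ∀ n : ℕ, ∑ j ∈ Finset.range n, (t ^ j) ^ 2 ≤ (t ^ n) ^ 2 := by
      intro n
      induction n with
      | zero => simp
      | succ n ih =>
        rw [Finset.sum_range_succ]
        have : (t ^ (n + 1)) ^ 2 = t ^ 2 * (t ^ n) ^ 2 := by ring
        rw [this]
        have h4 : 2 ≤ t ^ 2 := by nlinarith
        have := mul_le_mul_of_nonneg_right h4 (sq_nonneg (t ^ n))
        linarith
    exact this N
  have hI : ∑ j ∈ Finset.range N, ‖α j‖ ^ 2 ≤ 4 * (1 / 2 * I) := by
    have h0 : 0 ≤ ∑ j ∈ Finset.range N, ‖α j‖ ^ 2 := Finset.sum_nonneg fun _ _ => by positivity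
    nlinarith [Real.pi_gt_three]
  have hI0 : 0 ≤ 1 / 2 * I := by
    have h0 : 0 ≤ ∑ j ∈ Finset.range N, ‖α j‖ ^ 2 := Finset.sum_nonneg fun _ _ => by positivity
    linarith
  refine le_of_sq_le_sq ?_ (by positivity)
  rw [mul_pow, Real.sq_sqrt hI0]
  calc _ ≤ _ := h2
    _ ≤ (4 * (1 / 2 * I)) * (t ^ N) ^ 2 := by gcongr
    _ = _ := by ring

/-! ### Riemann sums of functions of bounded variation -/

/-- `P` majorizes the variation of `f` on `[-1, 1]`: every increment of `f` is bounded by the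
corresponding increment of `P`.  (In particular `P` is monotone on `[-1, 1]`.) -/
def IsVariationMajorant (f P : ℝ → ℝ) : Prop :=
  ∀ ⦃x⦄, x ∈ Icc (-1 : ℝ) 1 → ∀ ⦃y⦄, y ∈ Icc (-1 : ℝ) 1 → x ≤ y → |f y - f x| ≤ P y - P x

namespace IsVariationMajorant

variable {f g P Q : ℝ → ℝ}

theorem monotoneOn (h : IsVariationMajorant f P) : MonotoneOn P (Icc (-1) 1) :=
  fun _ hx _ hy hxy => sub_nonneg.mp ((abs_nonneg _).trans (h hx hy hxy))

protected theorem id : IsVariationMajorant id id := fun x _ y _ hxy => by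
  simp [abs_of_nonneg (sub_nonneg.mpr hxy)]

theorem congr (h : IsVariationMajorant f P) (hfg : EqOn f g (Icc (-1) 1)) :
    IsVariationMajorant g P :=
  fun x hx y hy hxy => by rw [← hfg hx, ← hfg hy]; exact h hx hy hxy

theorem add (hf : IsVariationMajorant f P) (hg : IsVariationMajorant g Q) :
    IsVariationMajorant (f + g) (P + Q) := fun x hx y hy hxy => by
  have h1 := abs_add_le (f y - f x) (g y - g x)
  have h2 := hf hx hy hxy
  have h3 := hg hx hy hxy
  simp only [Pi.add_apply]
  rw [show f y + g y - (f x + g x) = f y - f x + (g y - g x) by ring]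
  linarith

theorem const_smul (hf : IsVariationMajorant f P) (c : ℝ) :
    IsVariationMajorant (c • f) (|c| • P) := fun x hx y hy hxy => by
  simp only [Pi.smul_apply, smul_eq_mul, ← mul_sub, abs_mul]
  exact mul_le_mul_of_nonneg_left (hf hx hy hxy) (abs_nonneg c)

theorem sum {ι : Type*} (s : Finset ι) {f P : ι → ℝ → ℝ}
    (h : ∀ i ∈ s, IsVariationMajorant (f i) (P i)) :
    IsVariationMajorant (∑ i ∈ s, f i) (∑ i ∈ s, P i) := fun x hx y hy hxy => by
  simp only [Finset.sum_apply, ← Finset.sum_sub_distrib]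
  exact (Finset.abs_sum_le_sum_abs _ _).trans (Finset.sum_le_sum fun i hi => h i hi hx hy hxy)

theorem intervalIntegrable (h : IsVariationMajorant f P) :
    IntervalIntegrable f MeasureTheory.volume (-1) 1 := by
  have h1 : IntervalIntegrable P MeasureTheory.volume (-1) 1 :=
    MonotoneOn.intervalIntegrable (by rw [uIcc_of_le (by norm_num)]; exact h.monotoneOn)
  have h2 : IntervalIntegrable (P - f) MeasureTheory.volume (-1) 1 := by
    refine MonotoneOn.intervalIntegrable ?_
    rw [uIcc_of_le (by norm_num)]
    intro x hx y hy hxy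
    have := (abs_le.mp (h hx hy hxy)).2
    simp only [Pi.sub_apply]
    linarith
  simpa using h1.sub h2

/-- The Riemann sum over one node in each of the `M` cells of length `2 / M` approximates the mean
over `[-1, 1]` up to the total variation divided by `M`. -/
theorem abs_riemannSum_sub_integral_le (h : IsVariationMajorant f P) {M : ℕ} (hM : 0 < M) {δ : ℝ}
    (hδ : 0 ≤ δ) (hδ' : δ ≤ 2 / (M : ℝ)) :
    |1 / (M : ℝ) * ∑ m ∈ Finset.range M, f (edmdNode M δ m) - 1 / 2 * ∫ x in (-1 : ℝ)..1, f x|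
      ≤ (P 1 - P (-1)) / M := by
  have hM' : (0 : ℝ) < M := by exact_mod_cast hM
  set u : ℕ → ℝ := fun m => -1 + 2 * (m : ℝ) / M with hu
  have hu0 : u 0 = -1 := by simp [hu]
  have huM : u M = 1 := by simp only [hu]; field_simp; norm_num
  have hmono : Monotone u := by
    intro m n hmn
    have : (m : ℝ) ≤ n := by exact_mod_cast hmn
    simp only [hu]
    gcongr
  have hstep : ∀ m, u (m + 1) - u m = 2 / M := by
    intro m; simp only [hu]; push_cast; field_simp; ring
  have hmem : ∀ m ≤ M, u m ∈ Icc (-1 : ℝ) 1 := fun m hm =>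
    ⟨hu0 ▸ hmono (Nat.zero_le m), huM ▸ hmono hm⟩
  have hnode : ∀ m, edmdNode M δ m ∈ Icc (u m) (u (m + 1)) := by
    intro m
    have h1 : edmdNode M δ m = u m + δ := by simp only [edmdNode, hu]; ring
    have := hstep m
    constructor <;> linarith
  have hint : ∀ m < M, IntervalIntegrable f MeasureTheory.volume (u m) (u (m + 1)) := by
    intro m hm
    refine h.intervalIntegrable.mono_set ?_
    rw [uIcc_of_le (hmono (Nat.le_succ m)), uIcc_of_le (by norm_num)]
    exact Icc_subset_Icc (hmem m hm.le).1 (hmem (m + 1) hm).2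
  have hcell : ∀ m < M, |2 / (M : ℝ) * f (edmdNode M δ m) - ∫ x in u m..u (m + 1), f x|
      ≤ 2 / (M : ℝ) * (P (u (m + 1)) - P (u m)) := by
    intro m hm
    have h1 : 2 / (M : ℝ) * f (edmdNode M δ m) - ∫ x in u m..u (m + 1), f x
        = ∫ x in u m..u (m + 1), (f (edmdNode M δ m) - f x) := by
      rw [intervalIntegral.integral_sub (by simp) (hint m hm), intervalIntegral.integral_const,
        hstep, smul_eq_mul]
    rw [h1, ← Real.norm_eq_abs]
    refine (intervalIntegral.norm_integral_le_of_norm_le_const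
      (C := P (u (m + 1)) - P (u m)) fun x hx => ?_).trans (le_of_eq ?_)
    · rw [uIoc_of_le (hmono (Nat.le_succ m))] at hx
      have hsub : Icc (u m) (u (m + 1)) ⊆ Icc (-1) 1 :=
        Icc_subset_Icc (hmem m hm.le).1 (hmem (m + 1) hm).2
      have hx' : x ∈ Icc (u m) (u (m + 1)) := Ioc_subset_Icc_self hx
      have hn := hnode m
      have hPm := h.monotoneOn
      have key : ∀ ⦃s⦄, s ∈ Icc (u m) (u (m + 1)) → ∀ ⦃t⦄, t ∈ Icc (u m) (u (m + 1)) →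
          s ≤ t → |f t - f s| ≤ P (u (m + 1)) - P (u m) := by
        intro s hs t ht hst
        have h2 := h (hsub hs) (hsub ht) hst
        have h3 := hPm (hmem m hm.le) (hsub hs) hs.1
        have h4 := hPm (hsub ht) (hmem (m + 1) hm) ht.2
        linarith
      rw [Real.norm_eq_abs]
      rcases le_total x (edmdNode M δ m) with hle | hle
      · exact key hx' hn hle
      · rw [abs_sub_comm]; exact key hn hx' hle
    · rw [hstep, abs_of_nonneg (by positivity)]; ring
  have hsum : ∫ x in (-1 : ℝ)..1, f x = ∑ m ∈ Finset.range M, ∫ x in u m..u (m + 1), f x := by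
    rw [intervalIntegral.sum_integral_adjacent_intervals hint, hu0, huM]
  have e : 1 / (M : ℝ) * ∑ m ∈ Finset.range M, f (edmdNode M δ m)
        - 1 / 2 * ∫ x in (-1 : ℝ)..1, f x
      = 1 / 2 * ∑ m ∈ Finset.range M,
        (2 / (M : ℝ) * f (edmdNode M δ m) - ∫ x in u m..u (m + 1), f x) := by
    rw [hsum, Finset.sum_sub_distrib, ← Finset.mul_sum]; ring
  rw [e, abs_mul, abs_of_pos (by norm_num : (0 : ℝ) < 1 / 2)]
  calc 1 / 2 * |_| ≤ 1 / 2 * ∑ m ∈ Finset.range M, 2 / (M : ℝ) * (P (u (m + 1)) - P (u m)) := by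
        gcongr
        exact (Finset.abs_sum_le_sum_abs _ _).trans
          (Finset.sum_le_sum fun m hm => hcell m (Finset.mem_range.mp hm))
    _ = (P 1 - P (-1)) / M := by
        rw [← Finset.mul_sum, Finset.sum_range_sub (fun m => P (u m)), hu0, huM]; ring

theorem pow_mul_pow (h : IsVariationMajorant f P) (hf : MapsTo f (Icc (-1) 1) (Icc (-1) 1))
    (k l : ℕ) :
    IsVariationMajorant (fun x => f x ^ k * x ^ l) (fun x => k * P x + l * x) := by
  intro x hx y hy hxy
  have hpow : ∀ (n : ℕ) {s t : ℝ}, s ∈ Icc (-1 : ℝ) 1 → t ∈ Icc (-1 : ℝ) 1 →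
      |s ^ n - t ^ n| ≤ n * |s - t| := by
    intro n s t hs ht
    have h1 : max |s| |t| ≤ 1 := max_le (abs_le.mpr hs) (abs_le.mpr ht)
    calc |s ^ n - t ^ n| ≤ |s - t| * n * max |s| |t| ^ (n - 1) := abs_pow_sub_pow_le s t n
      _ ≤ |s - t| * n * 1 := by gcongr; exact pow_le_one₀ (by positivity) h1
      _ = _ := by ring
  have habs : ∀ (n : ℕ) {s : ℝ}, s ∈ Icc (-1 : ℝ) 1 → |s ^ n| ≤ 1 := fun n s hs => by
    rw [abs_pow]; exact pow_le_one₀ (abs_nonneg _) (abs_le.mpr hs)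
  have e : f y ^ k * y ^ l - f x ^ k * x ^ l
      = (f y ^ k - f x ^ k) * y ^ l + f x ^ k * (y ^ l - x ^ l) := by ring
  simp only [e]
  refine (abs_add_le _ _).trans ?_
  rw [abs_mul, abs_mul]
  have h1 : |f y ^ k - f x ^ k| * |y ^ l| ≤ k * (P y - P x) * 1 := by
    gcongr
    · exact mul_nonneg (by positivity) ((abs_nonneg _).trans (h hx hy hxy))
    · exact (hpow k (hf hy) (hf hx)).trans (by gcongr; exact h hx hy hxy)
    · exact habs l hy
  have h2 : |f x ^ k| * |y ^ l - x ^ l| ≤ 1 * (l * (y - x)) := by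
    gcongr
    · exact habs k (hf hx)
    · exact (hpow l hy hx).trans (by rw [abs_of_nonneg (sub_nonneg.mpr hxy)])
  linarith

/-- A monotone function on an open interval, extended by `0`, jumps at both endpoints; the majorant
leaves room for jumps of size at most `1` there. -/
theorem indicator_Ioo_of_monotoneOn {a b : ℝ} (hf : MonotoneOn f (Ioo a b))
    (hf1 : MapsTo f (Ioo a b) (Ioo (-1) 1)) :
    ∃ P, IsVariationMajorant ((Ioo a b).indicator f) P := by
  classical
  refine ⟨fun x => if x ≤ a then 0 else if x < b then f x + 2 else 4, fun x _ y _ hxy => ?_⟩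
  simp only [indicator_apply, mem_Ioo]
  have hx1 : x ∈ Ioo a b → f x ∈ Ioo (-1 : ℝ) 1 := fun h => hf1 h
  have hy1 : y ∈ Ioo a b → f y ∈ Ioo (-1 : ℝ) 1 := fun h => hf1 h
  have hm : x ∈ Ioo a b → y ∈ Ioo a b → f x ≤ f y := fun h h' => hf h h' hxy
  simp only [mem_Ioo] at hx1 hy1 hm
  rw [abs_le]
  grind

theorem indicator_Ioo_of_antitoneOn {a b : ℝ} (hf : AntitoneOn f (Ioo a b))
    (hf1 : MapsTo f (Ioo a b) (Ioo (-1) 1)) :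
    ∃ P, IsVariationMajorant ((Ioo a b).indicator f) P := by
  obtain ⟨P, hP⟩ := indicator_Ioo_of_monotoneOn (f := -f) hf.neg
    (fun x hx => by have := hf1 hx; simp only [mem_Ioo, Pi.neg_apply] at *; constructor <;> linarith)
  refine ⟨_, (hP.const_smul (-1)).congr fun x _ => ?_⟩
  by_cases hx : x ∈ Ioo a b <;> simp [hx]

theorem indicator_singleton (p : ℝ) :
    ∃ P, IsVariationMajorant (({p} : Set ℝ).indicator 1) P := by
  classical
  refine ⟨fun x => if x < p then 0 else if x = p then 1 else 2, fun x _ y _ hxy => ?_⟩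
  simp only [indicator_apply, mem_singleton_iff, Pi.one_apply]
  rw [abs_le]
  grind

/-- Changing a function of bounded variation at finitely many points keeps it of bounded
variation. -/
theorem of_eqOn_compl_finset (hf : ∃ P, IsVariationMajorant f P) (E : Finset ℝ)
    (h : ∀ x ∈ Icc (-1 : ℝ) 1, x ∉ E → g x = f x) : ∃ P, IsVariationMajorant g P := by
  classical
  obtain ⟨P, hP⟩ := hf
  choose Q hQ using indicator_singleton
  refine ⟨_, (hP.add (sum E fun p _ => (hQ p).const_smul (g p - f p))).congr fun x hx => ?_⟩
  simp only [Pi.add_apply, Finset.sum_apply, Pi.smul_apply, indicator_apply, mem_singleton_iff,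
    Pi.one_apply, smul_eq_mul, mul_ite, mul_one, mul_zero, Finset.sum_ite_eq]
  split_ifs with hE
  · ring
  · rw [h x hx hE, add_zero]

end IsVariationMajorant

namespace IsAnalyticFullBranchMap

variable {d : ℕ} {T : ℝ → ℝ} {a b : Fin d → ℝ}

theorem lt (hT : IsAnalyticFullBranchMap T a b) (l : Fin d) : a l < b l := by
  have h0 : (0 : ℝ) ∈ Ioo (-1 : ℝ) 1 := by norm_num
  obtain ⟨x, hx, -⟩ := (hT.bijOn l).surjOn h0
  exact hx.1.trans hx.2

theorem exists_mem_Ioo (hT : IsAnalyticFullBranchMap T a b) {x : ℝ} (hx : x ∈ Icc (-1 : ℝ) 1)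
    (ha : ∀ l, x ≠ a l) (hb : ∀ l, x ≠ b l) : ∃ l, x ∈ Ioo (a l) (b l) := by
  rw [← hT.iUnion_eq, mem_iUnion] at hx
  obtain ⟨l, hl⟩ := hx
  exact ⟨l, lt_of_le_of_ne hl.1 (ha l).symm, lt_of_le_of_ne hl.2 (hb l)⟩

/-- A full branch map has bounded variation: it is monotone on each open branch, and its values at
the finitely many endpoints are irrelevant. -/
theorem exists_isVariationMajorant (hT : IsAnalyticFullBranchMap T a b) :
    ∃ P, IsVariationMajorant T P := by
  classical
  have h1 : ∀ l, ∃ P, IsVariationMajorant ((Ioo (a l) (b l)).indicator T) P := by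
    intro l
    rcases (ContinuousOn.strictMonoOn_of_injOn_Ioo (hT.lt l)
      (hT.analytic l).continuousOn (hT.bijOn l).injOn) with h | h
    · exact IsVariationMajorant.indicator_Ioo_of_monotoneOn h.monotoneOn (hT.bijOn l).mapsTo
    · exact IsVariationMajorant.indicator_Ioo_of_antitoneOn h.antitoneOn (hT.bijOn l).mapsTo
  choose P hP using h1
  refine IsVariationMajorant.of_eqOn_compl_finset
    ⟨_, IsVariationMajorant.sum Finset.univ fun l _ => hP l⟩
    (Finset.univ.image a ∪ Finset.univ.image b) fun x hx hxE => ?_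
  simp only [Finset.mem_union, Finset.mem_image, Finset.mem_univ, true_and, not_or,
    not_exists] at hxE
  obtain ⟨l, hl⟩ := hT.exists_mem_Ioo hx (fun l h => hxE.1 l h.symm) (fun l h => hxE.2 l h.symm)
  rw [Finset.sum_apply, Finset.sum_eq_single l, indicator_of_mem hl]
  · intro l' _ hne
    exact indicator_of_notMem (fun h => (disjoint_left.mp (hT.disjoint hne)) h hl) _
  · simp

end IsAnalyticFullBranchMap

/-! ### Inverse branches and duality -/

/-- The function `y ↦ ∑ σ φ'(y) φ(y)^j`, the image of the monomial `z^j` under the transfer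
operator. -/
noncomputable abbrev transferMonomial {d : ℕ} (φ : Fin d → ℂ → ℂ) (j : ℕ) : ℂ → ℂ :=
  transferOp φ fun z => z ^ j

namespace HasAnalyticInverseBranches

variable {d : ℕ} {T : ℝ → ℝ} {a b : Fin d → ℝ} {φ : Fin d → ℂ → ℂ} {r R : ℝ}

theorem ofReal_mem_ball (hφ : HasAnalyticInverseBranches T a b φ r R) {y : ℝ}
    (hy : y ∈ Icc (-1 : ℝ) 1) : (y : ℂ) ∈ Metric.ball (0 : ℂ) R := by
  have h := abs_le.mpr hy
  have h1 := hφ.one_lt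
  have h2 := hφ.lt
  rw [mem_ball_zero_iff, Complex.norm_real, Real.norm_eq_abs]
  linarith

theorem hasDerivAt (hφ : HasAnalyticInverseBranches T a b φ r R) (l : Fin d) {z : ℂ}
    (hz : z ∈ Metric.ball (0 : ℂ) R) : HasDerivAt (φ l) (deriv (φ l) z) z :=
  ((hφ.differentiableOn l).differentiableAt (Metric.isOpen_ball.mem_nhds hz)).hasDerivAt

theorem continuousOn_deriv (hφ : HasAnalyticInverseBranches T a b φ r R) (l : Fin d) :
    ContinuousOn (deriv (φ l)) (Metric.ball 0 R) :=
  ((hφ.differentiableOn l).deriv Metric.isOpen_ball).continuousOn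

theorem exists_preimage (hT : IsAnalyticFullBranchMap T a b)
    (hφ : HasAnalyticInverseBranches T a b φ r R) (l : Fin d) {y : ℝ} (hy : y ∈ Ioo (-1 : ℝ) 1) :
    ∃ x ∈ Ioo (a l) (b l), T x = y ∧ φ l (y : ℂ) = (x : ℂ) := by
  obtain ⟨x, hx, rfl⟩ := (hT.bijOn l).surjOn hy
  exact ⟨x, hx, rfl, hφ.inverse l x hx⟩

theorem re_eq (hφ : HasAnalyticInverseBranches T a b φ r R) (l : Fin d) {x : ℝ}
    (hx : x ∈ Ioo (a l) (b l)) : (φ l ((T x : ℝ) : ℂ)).re = x := by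
  rw [hφ.inverse l x hx, Complex.ofReal_re]

theorem image_re (hT : IsAnalyticFullBranchMap T a b)
    (hφ : HasAnalyticInverseBranches T a b φ r R) (l : Fin d) :
    (fun y : ℝ => (φ l (y : ℂ)).re) '' Ioo (-1 : ℝ) 1 = Ioo (a l) (b l) := by
  ext x
  constructor
  · rintro ⟨y, hy, rfl⟩
    obtain ⟨x, hx, -, hxy⟩ := hφ.exists_preimage hT l hy
    simpa [hxy] using hx
  · intro hx
    exact ⟨T x, (hT.bijOn l).mapsTo hx, hφ.re_eq l hx⟩

theorem injOn_re (hT : IsAnalyticFullBranchMap T a b)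
    (hφ : HasAnalyticInverseBranches T a b φ r R) (l : Fin d) :
    InjOn (fun y : ℝ => (φ l (y : ℂ)).re) (Ioo (-1 : ℝ) 1) := by
  intro y hy y' hy' h
  obtain ⟨x, hx, rfl, -⟩ := hφ.exists_preimage hT l hy
  obtain ⟨x', hx', rfl, -⟩ := hφ.exists_preimage hT l hy'
  simp only [hφ.re_eq l hx, hφ.re_eq l hx'] at h
  rw [h]

theorem hasDerivAt_re (hφ : HasAnalyticInverseBranches T a b φ r R) (l : Fin d) {y : ℝ}
    (hy : y ∈ Icc (-1 : ℝ) 1) :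
    HasDerivAt (fun y : ℝ => (φ l (y : ℂ)).re) (deriv (φ l) y).re y :=
  (hφ.hasDerivAt l (hφ.ofReal_mem_ball hy)).real_of_complex

/-- The inverse branches are real on `(-1, 1)`, hence so are their derivatives. -/
theorem im_deriv_eq_zero (hT : IsAnalyticFullBranchMap T a b)
    (hφ : HasAnalyticInverseBranches T a b φ r R) (l : Fin d) {y : ℝ}
    (hy : y ∈ Ioo (-1 : ℝ) 1) : (deriv (φ l) y).im = 0 := by
  have h1 := (hφ.hasDerivAt l (hφ.ofReal_mem_ball (Ioo_subset_Icc_self hy))).comp_ofReal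
  have h2 : HasDerivAt (fun y : ℝ => (φ l (y : ℂ)).im) (deriv (φ l) y).im y :=
    Complex.imCLM.hasFDerivAt.comp_hasDerivAt y h1
  have h3 : (fun y : ℝ => (φ l (y : ℂ)).im) =ᶠ[𝓝 y] fun _ => 0 := by
    filter_upwards [isOpen_Ioo.mem_nhds hy] with t ht
    obtain ⟨x, -, -, hx⟩ := hφ.exists_preimage hT l ht
    simp [hx]
  exact h2.unique ((hasDerivAt_const y (0 : ℝ)).congr_of_eventuallyEq h3)

theorem re_deriv_ne_zero (hT : IsAnalyticFullBranchMap T a b)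
    (hφ : HasAnalyticInverseBranches T a b φ r R) (l : Fin d) {y : ℝ}
    (hy : y ∈ Ioo (-1 : ℝ) 1) : (deriv (φ l) y).re ≠ 0 := by
  obtain ⟨x, hx, rfl, -⟩ := hφ.exists_preimage hT l hy
  have h1 := hφ.hasDerivAt_re l (Ioo_subset_Icc_self hy)
  have h2 := ((hT.analytic l) x hx).differentiableAt.hasDerivAt
  have h3 := h1.comp x h2
  have h4 : ((fun y : ℝ => (φ l (y : ℂ)).re) ∘ T) =ᶠ[𝓝 x] id := by
    filter_upwards [isOpen_Ioo.mem_nhds hx] with t ht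
    exact hφ.re_eq l ht
  have h5 := h3.unique ((hasDerivAt_id x).congr_of_eventuallyEq h4)
  exact left_ne_zero_of_mul_eq_one h5

/-- Each inverse branch is strictly monotone on `(-1, 1)`, so its derivative has the sign that it
has at `0`. -/
theorem ofReal_abs_re_deriv (hT : IsAnalyticFullBranchMap T a b)
    (hφ : HasAnalyticInverseBranches T a b φ r R) (l : Fin d) {y : ℝ} (hy : y ∈ Ioo (-1 : ℝ) 1) :
    ((|(deriv (φ l) y).re| : ℝ) : ℂ)
      = ((Real.sign (deriv (φ l) 0).re : ℝ) : ℂ) * deriv (φ l) y := by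
  have h0 : (0 : ℝ) ∈ Ioo (-1 : ℝ) 1 := by norm_num
  have hre : deriv (φ l) y = ((deriv (φ l) y).re : ℂ) :=
    Complex.ext (by simp) (by simp [hφ.im_deriv_eq_zero hT l hy])
  have hcont : ContinuousOn (fun y : ℝ => (φ l (y : ℂ)).re) (Ioo (-1 : ℝ) 1) := fun t ht =>
    (hφ.hasDerivAt_re l (Ioo_subset_Icc_self ht)).continuousAt.continuousWithinAt
  have hd : ∀ t ∈ Ioo (-1 : ℝ) 1, (deriv (φ l) t).re
      = derivWithin (fun y : ℝ => (φ l (y : ℂ)).re) (Ioo (-1 : ℝ) 1) t := fun t ht =>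
    ((hφ.hasDerivAt_re l (Ioo_subset_Icc_self ht)).hasDerivWithinAt.derivWithin
      (isOpen_Ioo.uniqueDiffWithinAt ht)).symm
  have hne := hφ.re_deriv_ne_zero hT l h0
  rw [Complex.ofReal_zero] at hne
  rw [hre, ← Complex.ofReal_mul]
  congr 1
  simp only [Complex.ofReal_re]
  rcases ContinuousOn.strictMonoOn_of_injOn_Ioo (by norm_num) hcont (hφ.injOn_re hT l) with h | h
  · have hnn : ∀ t ∈ Ioo (-1 : ℝ) 1, 0 ≤ (deriv (φ l) t).re := fun t ht => by
      rw [hd t ht]; exact h.monotoneOn.derivWithin_nonneg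
    have h00 := hnn 0 h0
    rw [Complex.ofReal_zero] at h00
    rw [abs_of_nonneg (hnn y hy), Real.sign_of_pos (lt_of_le_of_ne h00 hne.symm), one_mul]
  · have hnn : ∀ t ∈ Ioo (-1 : ℝ) 1, (deriv (φ l) t).re ≤ 0 := fun t ht => by
      rw [hd t ht]; exact h.antitoneOn.derivWithin_nonpos
    have h00 := hnn 0 h0
    rw [Complex.ofReal_zero] at h00
    rw [abs_of_nonpos (hnn y hy), Real.sign_of_neg (lt_of_le_of_ne h00 hne), neg_one_mul]

theorem continuousOn_pow_mul_branch (hφ : HasAnalyticInverseBranches T a b φ r R) (l : Fin d)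
    (k j : ℕ) : ContinuousOn (fun y : ℝ => (y : ℂ) ^ k *
      (((Real.sign (deriv (φ l) 0).re : ℝ) : ℂ) * deriv (φ l) y * φ l y ^ j)) (Icc (-1) 1) := by
  have hm : MapsTo (fun y : ℝ => (y : ℂ)) (Icc (-1) 1) (Metric.ball (0 : ℂ) R) :=
    fun y hy => hφ.ofReal_mem_ball hy
  have h1 := (hφ.continuousOn_deriv l).comp Complex.continuous_ofReal.continuousOn hm
  have h2 := (hφ.differentiableOn l).continuousOn.comp Complex.continuous_ofReal.continuousOn hm
  exact (Complex.continuous_ofReal.pow k).continuousOn.mul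
    ((continuousOn_const.mul h1).mul (h2.pow j))

/-- Duality of the composition with `T` and the transfer operator, on monomials: substitute
`x = φ_l(y)` on each branch. -/
theorem integral_pow_mul_pow_eq (hT : IsAnalyticFullBranchMap T a b)
    (hφ : HasAnalyticInverseBranches T a b φ r R) (k j : ℕ) :
    ((∫ x in (-1 : ℝ)..1, T x ^ k * x ^ j : ℝ) : ℂ)
      = ∫ y in (-1 : ℝ)..1, (y : ℂ) ^ k * transferMonomial φ j (y : ℂ) := by
  classical
  obtain ⟨P, hP⟩ := hT.exists_isVariationMajorant
  have hint := (hP.pow_mul_pow hT.mapsTo k j).intervalIntegrable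
  rw [intervalIntegrable_iff_integrableOn_Icc_of_le (by norm_num)] at hint
  have hsub : ∀ l, Ioo (a l) (b l) ⊆ Icc (-1 : ℝ) 1 := fun l x hx => by
    rw [← hT.iUnion_eq]; exact mem_iUnion.mpr ⟨l, Ioo_subset_Icc_self hx⟩
  have hae : Icc (-1 : ℝ) 1 =ᵐ[MeasureTheory.volume] ⋃ l, Ioo (a l) (b l) := by
    have hfin : (range a ∪ range b).Finite := (finite_range a).union (finite_range b)
    have h0 := hfin.measure_zero MeasureTheory.volume
    refine Filter.EventuallyLE.antisymm ?_ (LE.le.eventuallyLE (iUnion_subset hsub))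
    filter_upwards [MeasureTheory.measure_eq_zero_iff_ae_notMem.mp h0] with x hx hxI
    simp only [mem_union, mem_range, not_or, not_exists] at hx
    exact mem_iUnion.mpr (hT.exists_mem_Ioo hxI (fun l h => hx.1 l h.symm)
      (fun l h => hx.2 l h.symm))
  have hbranch : ∀ l, ((∫ x in Ioo (a l) (b l), T x ^ k * x ^ j : ℝ) : ℂ)
      = ∫ y in (-1 : ℝ)..1, (y : ℂ) ^ k *
        (((Real.sign (deriv (φ l) 0).re : ℝ) : ℂ) * deriv (φ l) y * φ l y ^ j) := by
    intro l
    rw [← hφ.image_re hT l, MeasureTheory.integral_image_eq_integral_abs_deriv_smul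
      measurableSet_Ioo
      (fun y hy => (hφ.hasDerivAt_re l (Ioo_subset_Icc_self hy)).hasDerivWithinAt)
      (hφ.injOn_re hT l), ← integral_complex_ofReal,
      intervalIntegral.integral_of_le (by norm_num), MeasureTheory.integral_Ioc_eq_integral_Ioo]
    refine MeasureTheory.setIntegral_congr_fun measurableSet_Ioo fun y hy => ?_
    obtain ⟨x, hx, rfl, hφx⟩ := hφ.exists_preimage hT l hy
    have := hφ.ofReal_abs_re_deriv hT l hy
    simp only [smul_eq_mul, Complex.ofReal_mul, this, hφx, Complex.ofReal_pow]
    simp only [Complex.ofReal_re]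
    ring
  rw [intervalIntegral.integral_of_le (by norm_num), ← MeasureTheory.integral_Icc_eq_integral_Ioc,
    MeasureTheory.setIntegral_congr_set hae, MeasureTheory.integral_iUnion_fintype
      (fun l => measurableSet_Ioo) hT.disjoint (fun l => hint.mono_set (hsub l)),
    Complex.ofReal_sum]
  simp only [hbranch]
  rw [← intervalIntegral.integral_finsetSum]
  · simp only [transferMonomial, transferOp, Finset.mul_sum]
  · intro l _
    refine ContinuousOn.intervalIntegrable ?_
    rw [uIcc_of_le (by norm_num)]
    exact hφ.continuousOn_pow_mul_branch l k j

end HasAnalyticInverseBranches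

/-! ### Taylor coefficients and the Hardy inner product -/

/-- The `n`-th Taylor coefficient at `0` of a function holomorphic on a disk of radius greater
than `1`, in the form of a Cauchy integral over the unit circle. -/
noncomputable def taylorCoeff (f : ℂ → ℂ) (n : ℕ) : ℂ := (cauchyPowerSeries f 0 1).coeff n

section taylorCoeff

variable {f : ℂ → ℂ} {R s : ℝ}

/-- By uniqueness of power series, the Cauchy integrals over circles of all radii below `R` give the
same coefficients. -/
theorem hasFPowerSeriesOnBall_cauchyPowerSeries_one (hf : DifferentiableOn ℂ f (Metric.ball 0 R))
    (hR : 1 < R) (hs : 0 < s) (hsR : s < R) :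
    cauchyPowerSeries f 0 s = cauchyPowerSeries f 0 1 ∧
      HasFPowerSeriesOnBall f (cauchyPowerSeries f 0 1) 0 (ENNReal.ofReal s) := by
  have h : ∀ {t : ℝ} (_ : 0 < t), t < R →
      HasFPowerSeriesOnBall f (cauchyPowerSeries f 0 t) 0 (ENNReal.ofReal t) := by
    intro t ht htR
    have h1 : DifferentiableOn ℂ f (Metric.closedBall 0 (t.toNNReal : ℝ)) := by
      rw [Real.coe_toNNReal t ht.le]
      exact hf.mono (Metric.closedBall_subset_ball htR)
    have h2 := h1.hasFPowerSeriesOnBall (Real.toNNReal_pos.mpr ht)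
    rwa [Real.coe_toNNReal t ht.le] at h2
  have hs' := h hs hsR
  have h1 := h one_pos hR
  have heq := hs'.hasFPowerSeriesAt.eq_formalMultilinearSeries h1.hasFPowerSeriesAt
  exact ⟨heq, heq ▸ hs'⟩

theorem hasSum_taylorCoeff (hf : DifferentiableOn ℂ f (Metric.ball 0 R)) (hR : 1 < R) {z : ℂ}
    (hz : z ∈ Metric.ball (0 : ℂ) R) : HasSum (fun n => taylorCoeff f n * z ^ n) (f z) := by
  rw [mem_ball_zero_iff] at hz
  obtain ⟨s, hs, hsR⟩ := exists_between hz
  have h := (hasFPowerSeriesOnBall_cauchyPowerSeries_one hf hR ((norm_nonneg z).trans_lt hs)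
    hsR).2.hasSum (y := z) (by simpa [enorm_eq_nnnorm, ENNReal.ofReal, ← NNReal.coe_lt_coe,
      ((norm_nonneg z).trans_lt hs).le] using hs)
  rw [zero_add] at h
  refine h.congr_fun fun n => ?_
  rw [FormalMultilinearSeries.apply_eq_pow_smul_coeff, smul_eq_mul, mul_comm, taylorCoeff]

theorem taylorCoeff_eq_integral (hf : DifferentiableOn ℂ f (Metric.ball 0 R)) (hR : 1 < R)
    (hs : 0 < s) (hsR : s < R) (n : ℕ) :
    taylorCoeff f n = 1 / (2 * (Real.pi : ℂ)) *
      ∫ t in (0 : ℝ)..(2 * Real.pi), f (circleMap 0 s t) * (circleMap 0 s t)⁻¹ ^ n := by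
  rw [taylorCoeff, ← (hasFPowerSeriesOnBall_cauchyPowerSeries_one hf hR hs hsR).1,
    FormalMultilinearSeries.coeff, show (1 : Fin n → ℂ) = fun _ => 1 from rfl,
    cauchyPowerSeries_apply, circleIntegral]
  simp only [sub_zero, smul_eq_mul, deriv_circleMap]
  have : ∀ t : ℝ, circleMap 0 s t * Complex.I * ((1 / circleMap 0 s t) ^ n *
      ((circleMap 0 s t)⁻¹ * f (circleMap 0 s t)))
      = Complex.I * (f (circleMap 0 s t) * (circleMap 0 s t)⁻¹ ^ n) := by
    intro t
    have h0 : circleMap 0 s t ≠ 0 := circleMap_ne_center hs.ne'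
    field_simp
  simp only [this]
  rw [intervalIntegral.integral_const_mul, ← mul_assoc]
  congr 1
  have := Complex.I_ne_zero
  field_simp

theorem norm_taylorCoeff_le (hf : DifferentiableOn ℂ f (Metric.ball 0 R)) (hR : 1 < R)
    (hs : 0 < s) (hsR : s < R) {B : ℝ} (hB : ∀ z, ‖z‖ = s → ‖f z‖ ≤ B) (n : ℕ) :
    ‖taylorCoeff f n‖ ≤ B * s⁻¹ ^ n := by
  rw [taylorCoeff_eq_integral hf hR hs hsR]
  have h : ‖∫ t in (0 : ℝ)..(2 * Real.pi), f (circleMap 0 s t) * (circleMap 0 s t)⁻¹ ^ n‖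
      ≤ B * s⁻¹ ^ n * |2 * Real.pi - 0| := by
    refine intervalIntegral.norm_integral_le_of_norm_le_const fun t _ => ?_
    have hn : ‖circleMap 0 s t‖ = s := by simp [abs_of_pos hs]
    rw [norm_mul, norm_pow, norm_inv, hn]
    gcongr
    exact hB _ hn
  rw [norm_mul]
  have hpi := Real.pi_pos
  rw [sub_zero, abs_of_pos (by positivity)] at h
  calc _ ≤ ‖1 / (2 * (Real.pi : ℂ))‖ * (B * s⁻¹ ^ n * (2 * Real.pi)) := by gcongr
    _ = _ := by
      simp only [one_div, norm_inv, norm_mul, Complex.norm_ofNat, Complex.norm_real,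
        Real.norm_eq_abs, abs_of_pos hpi]
      field_simp

/-- The Hardy space inner product with `e_k` reads off the `k`-th Taylor coefficient: on the circle
of radius `s` the conjugate of `w` is `s² / w`. -/
theorem hasHardyInner_hardyBasis {ρ : ℝ} (hf : DifferentiableOn ℂ f (Metric.ball 0 R))
    (hR : 1 < R) (hρ : 0 < ρ) (hρR : ρ < R) (k : ℕ) :
    HasHardyInner ρ f (hardyBasis ρ k) ((ρ : ℂ) ^ k * taylorCoeff f k) := by
  have hlim : Tendsto (fun s : ℝ => ((s : ℂ) ^ 2 / ρ) ^ k * taylorCoeff f k) (𝓝[<] ρ)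
      (𝓝 (((ρ : ℂ) ^ 2 / ρ) ^ k * taylorCoeff f k)) := by
    have : Continuous fun s : ℝ => ((s : ℂ) ^ 2 / ρ) ^ k * taylorCoeff f k := by fun_prop
    exact this.continuousAt.tendsto.mono_left nhdsWithin_le_nhds
  have hρ' : (ρ : ℂ) ≠ 0 := by exact_mod_cast hρ.ne'
  rw [show (ρ : ℂ) ^ 2 / ρ = ρ by field_simp] at hlim
  refine hlim.congr' ?_
  filter_upwards [Ioo_mem_nhdsLT hρ] with s hs
  rw [taylorCoeff_eq_integral hf hR hs.1 (hs.2.trans hρR), mul_left_comm,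
    ← intervalIntegral.integral_const_mul]
  congr 1
  refine intervalIntegral.integral_congr fun t _ => ?_
  have hw : circleMap 0 s t * star (circleMap 0 s t) = (s : ℂ) ^ 2 := by
    have := Complex.mul_conj (circleMap 0 s t)
    rw [Complex.normSq_eq_norm_sq, norm_circleMap_zero, sq_abs] at this
    rw [← Complex.ofReal_pow, ← this]
    rfl
  have h0 : circleMap 0 s t ≠ 0 := circleMap_ne_center hs.1.ne'
  have hst : star (circleMap 0 s t / (ρ : ℂ)) = (s : ℂ) ^ 2 / ρ * (circleMap 0 s t)⁻¹ := by
    rw [← hw, star_div₀, Complex.star_def, Complex.conj_ofReal]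
    field_simp
  simp only [hardyBasis, star_pow, hst, mul_pow]
  ring

end taylorCoeff

namespace HasAnalyticInverseBranches

variable {d : ℕ} {T : ℝ → ℝ} {a b : Fin d → ℝ} {φ : Fin d → ℂ → ℂ} {r R : ℝ}

theorem differentiableOn_transferOp (hφ : HasAnalyticInverseBranches T a b φ r R) {f : ℂ → ℂ}
    (hf : Differentiable ℂ f) : DifferentiableOn ℂ (transferOp φ f) (Metric.ball 0 R) := by
  unfold transferOp
  refine DifferentiableOn.fun_sum fun l _ => ?_
  have h1 := (hφ.differentiableOn l).deriv Metric.isOpen_ball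
  exact ((differentiableOn_const _).mul h1).mul (hf.comp_differentiableOn (hφ.differentiableOn l))

theorem exists_norm_transferMonomial_le (hφ : HasAnalyticInverseBranches T a b φ r R) {s : ℝ}
    (hs : s < R) : ∃ K : ℝ, 0 < K ∧ ∀ (j : ℕ) (z : ℂ), ‖z‖ ≤ s →
      ‖transferMonomial φ j z‖ ≤ K * r ^ j := by
  have h1 : ∀ l, ∃ B : ℝ, ∀ z ∈ Metric.closedBall (0 : ℂ) s, ‖deriv (φ l) z‖ ≤ B := fun l =>
    (isCompact_closedBall 0 s).exists_bound_of_continuousOn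
      ((hφ.continuousOn_deriv l).mono (Metric.closedBall_subset_ball hs))
  choose B hB using h1
  have hr : 0 < r := one_pos.trans hφ.one_lt
  have hsg : ∀ x : ℝ, |Real.sign x| ≤ 1 := fun x => by
    rcases Real.sign_apply_eq x with h | h | h <;> simp [h]
  refine ⟨∑ l, |B l| + 1, by positivity, fun j z hz => ?_⟩
  have hz' : z ∈ Metric.closedBall (0 : ℂ) s := by simpa using hz
  calc ‖transferMonomial φ j z‖ ≤ ∑ l, ‖((Real.sign (deriv (φ l) 0).re : ℝ) : ℂ) *
        deriv (φ l) z * φ l z ^ j‖ := norm_sum_le _ _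
    _ ≤ ∑ l, |B l| * r ^ j := by
        refine Finset.sum_le_sum fun l _ => ?_
        rw [norm_mul, norm_mul, norm_pow, Complex.norm_real, Real.norm_eq_abs]
        have h2 : ‖φ l z‖ ≤ r := by
          have := hφ.mapsTo l (Metric.closedBall_subset_ball hs hz')
          exact (mem_ball_zero_iff.mp this).le
        have h3 := (hB l z hz').trans (le_abs_self _)
        calc _ ≤ 1 * |B l| * r ^ j := by gcongr; exact hsg _
          _ = _ := by ring
    _ ≤ (∑ l, |B l| + 1) * r ^ j := by
        rw [← Finset.sum_mul]; gcongr; linarith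

/-- The factor `r ^ j` comes from `φ_l` mapping into the disk of radius `r`, the factor `s⁻¹ ^ n`
from Cauchy's estimate on the circle of radius `s`. -/
theorem exists_norm_taylorCoeff_le (hφ : HasAnalyticInverseBranches T a b φ r R) {s : ℝ}
    (hs : 0 < s) (hsR : s < R) : ∃ K : ℝ, 0 < K ∧ ∀ j n : ℕ,
      ‖taylorCoeff (transferMonomial φ j) n‖ ≤ K * r ^ j * s⁻¹ ^ n := by
  obtain ⟨K, hK, h⟩ := hφ.exists_norm_transferMonomial_le hsR
  exact ⟨K, hK, fun j n => norm_taylorCoeff_le (hφ.differentiableOn_transferOp (by fun_prop))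
    (hφ.one_lt.trans hφ.lt) hs hsR (fun z hz => h j z hz.le) n⟩

theorem hasHardyInner_transferOp (hφ : HasAnalyticInverseBranches T a b φ r R) {ρ : ℝ}
    (hρ : 0 < ρ) (hρR : ρ < R) (k l : ℕ) :
    HasHardyInner ρ (transferOp φ (hardyBasis ρ l)) (hardyBasis ρ k)
      ((ρ : ℂ) ^ k * taylorCoeff (transferMonomial φ l) k * ((ρ : ℂ) ^ l)⁻¹) := by
  have h := hasHardyInner_hardyBasis (hφ.differentiableOn_transferOp (f := fun z => z ^ l)
    (by fun_prop)) (hφ.one_lt.trans hφ.lt) hρ hρR k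
  have h2 := h.mul_const ((ρ : ℂ) ^ l)⁻¹
  refine h2.congr fun s => ?_
  rw [mul_assoc, ← intervalIntegral.integral_mul_const]
  congr 1
  refine intervalIntegral.integral_congr fun t _ => ?_
  simp only [transferOp, hardyBasis, Finset.sum_mul, div_pow]
  refine Finset.sum_congr rfl fun i _ => ?_
  ring

end HasAnalyticInverseBranches

/-! ### Stability of the moment matrix -/

theorem edmdNode_injective {M : ℕ} (hM : 0 < M) (δ : ℝ) : Function.Injective (edmdNode M δ) := by
  intro m n h
  have hM' : (0 : ℝ) < M := by exact_mod_cast hM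
  unfold edmdNode at h
  field_simp at h
  have : (m : ℝ) = n := by linarith
  exact_mod_cast this

open Polynomial in
/-- The polynomial with coefficient vector `c`. -/
noncomputable def polyOf {N : ℕ} (c : Fin N → ℂ) : ℂ[X] := ∑ k : Fin N, C (c k) * X ^ (k : ℕ)

section polyOf

variable {N : ℕ} (c : Fin N → ℂ)

open Polynomial in
theorem polyOf_coeff (k : Fin N) : (polyOf c).coeff k = c k := by
  simp only [polyOf, finsetSum_coeff, coeff_C_mul_X_pow]
  rw [Finset.sum_eq_single k]
  · simp
  · intro j _ hj
    rw [if_neg (fun h => hj (Fin.ext h.symm))]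
  · simp

open Polynomial in
theorem polyOf_degree_lt : (polyOf c).degree < N := by
  refine (degree_sum_le _ _).trans_lt ((Finset.sup_lt_iff (WithBot.bot_lt_coe N)).mpr fun k _ => ?_)
  exact (degree_C_mul_X_pow_le _ _).trans_lt (Nat.cast_lt.mpr k.2)

theorem polyOf_eval (z : ℂ) : (polyOf c).eval z = ∑ k : Fin N, c k * z ^ (k : ℕ) := by
  simp [polyOf, Polynomial.eval_finsetSum]

/-- The quadratic form of the matrix `edmdH` is the mean square of the polynomial on the nodes. -/
theorem sum_star_mul_edmdH_mulVec (M : ℕ) (δ : ℝ) :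
    ∑ k, star (c k) * (edmdH M δ N).mulVec c k
      = ((1 / (M : ℝ) * ∑ m ∈ Finset.range M,
        ‖(polyOf c).eval (edmdNode M δ m : ℂ)‖ ^ 2 : ℝ) : ℂ) := by
  have h : ∀ x : ℝ, ((‖(polyOf c).eval (x : ℂ)‖ ^ 2 : ℝ) : ℂ)
      = ∑ k : Fin N, ∑ l : Fin N, star (c k) * (c l * ((x : ℂ) ^ (k : ℕ) * (x : ℂ) ^ (l : ℕ))) := by
    intro x
    rw [← Complex.normSq_eq_norm_sq, ← Complex.mul_conj, mul_comm, polyOf_eval, map_sum,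
      Finset.sum_mul_sum]
    refine Finset.sum_congr rfl fun k _ => Finset.sum_congr rfl fun l _ => ?_
    rw [map_mul, map_pow, Complex.conj_ofReal, Complex.star_def]
    ring
  rw [Complex.ofReal_mul, Complex.ofReal_sum]
  simp only [h]
  rw [Finset.sum_comm, Finset.mul_sum]
  refine Finset.sum_congr rfl fun k _ => ?_
  rw [Finset.sum_comm, Finset.mul_sum, Matrix.mulVec, dotProduct, Finset.mul_sum]
  refine Finset.sum_congr rfl fun l _ => ?_
  simp only [edmdH, Matrix.of_apply, ← Finset.mul_sum]
  push_cast
  ring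

theorem norm_polyOf_eval_le {x : ℝ} (hx : x ∈ Icc (-1 : ℝ) 1) :
    ‖(polyOf c).eval (x : ℂ)‖ ≤ ∑ k, ‖c k‖ := by
  rw [polyOf_eval]
  refine (norm_sum_le _ _).trans (Finset.sum_le_sum fun k _ => ?_)
  rw [norm_mul, norm_pow, Complex.norm_real, Real.norm_eq_abs]
  exact mul_le_of_le_one_right (norm_nonneg _) (pow_le_one₀ (abs_nonneg _) (abs_le.mpr hx))

/-- On `[-1, 1]` the modulus of the polynomial is at most `∑ |c k|`, and its Lipschitz constant at
most `N ∑ |c k|`. -/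
theorem isVariationMajorant_normSq_polyOf :
    IsVariationMajorant (fun x => ‖(polyOf c).eval (x : ℂ)‖ ^ 2)
      (fun x => 2 * N * (∑ k, ‖c k‖) ^ 2 * x) := by
  intro x hx y hy hxy
  set A := ∑ k, ‖c k‖ with hA
  have hA0 : 0 ≤ A := Finset.sum_nonneg fun _ _ => norm_nonneg _
  have h1 : ‖(polyOf c).eval (y : ℂ) - (polyOf c).eval (x : ℂ)‖ ≤ A * (N * (y - x)) := by
    rw [polyOf_eval, polyOf_eval, ← Finset.sum_sub_distrib, hA, Finset.sum_mul]
    refine (norm_sum_le _ _).trans (Finset.sum_le_sum fun k _ => ?_)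
    rw [← mul_sub, norm_mul]
    gcongr
    have h2 := IsVariationMajorant.id.pow_mul_pow (fun x hx => hx) k 0 hx hy hxy
    simp only [id, pow_zero, mul_one, Nat.cast_zero, zero_mul, add_zero, ← mul_sub] at h2
    rw [← Complex.ofReal_pow, ← Complex.ofReal_pow, ← Complex.ofReal_sub, Complex.norm_real,
      Real.norm_eq_abs]
    refine h2.trans ?_
    have : ((k : ℕ) : ℝ) ≤ N := by exact_mod_cast k.2.le
    exact mul_le_mul_of_nonneg_right this (sub_nonneg.mpr hxy)
  have h3 := norm_polyOf_eval_le c hx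
  have h4 := norm_polyOf_eval_le c hy
  have h5 := (abs_norm_sub_norm_le _ _).trans h1
  have e : ‖(polyOf c).eval (y : ℂ)‖ ^ 2 - ‖(polyOf c).eval (x : ℂ)‖ ^ 2
      = (‖(polyOf c).eval (y : ℂ)‖ + ‖(polyOf c).eval (x : ℂ)‖)
        * (‖(polyOf c).eval (y : ℂ)‖ - ‖(polyOf c).eval (x : ℂ)‖) := by ring
  simp only [e, abs_mul]
  rw [abs_of_nonneg (by positivity : (0 : ℝ) ≤
    ‖(polyOf c).eval (y : ℂ)‖ + ‖(polyOf c).eval (x : ℂ)‖)]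
  calc _ ≤ (A + A) * (A * (N * (y - x))) := by gcongr
    _ = _ := by ring

end polyOf

/-- A vector in the kernel of `edmdH` gives a polynomial of degree less than `N` that vanishes at the
`M ≥ N` distinct nodes. -/
theorem isUnit_det_edmdH {N M : ℕ} (hM : 0 < M) (hNM : N ≤ M) (δ : ℝ) :
    IsUnit (edmdH M δ N).det := by
  rw [isUnit_iff_ne_zero]
  intro hdet
  obtain ⟨c, hc, hHc⟩ := Matrix.exists_mulVec_eq_zero_iff.mpr hdet
  have hM' : (0 : ℝ) < M := by exact_mod_cast hM
  have h := sum_star_mul_edmdH_mulVec c M δ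
  simp only [hHc, Pi.zero_apply, mul_zero, Finset.sum_const_zero] at h
  have h' : 1 / (M : ℝ) * ∑ m ∈ Finset.range M,
        ‖(polyOf c).eval (edmdNode M δ m : ℂ)‖ ^ 2 = 0 := by exact_mod_cast h.symm
  have h2 : ∀ m ∈ Finset.range M, (polyOf c).eval (edmdNode M δ m : ℂ) = 0 := by
    intro m hm
    have h3 := (mul_eq_zero.mp h').resolve_left (by positivity)
    have h4 := (Finset.sum_eq_zero_iff_of_nonneg fun _ _ => by positivity).mp h3 m hm
    simpa using h4
  have hp : polyOf c = 0 := by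
    refine Polynomial.eq_zero_of_degree_lt_of_eval_finset_eq_zero
      ((Finset.range M).map ⟨fun m => (edmdNode M δ m : ℂ),
        fun m n hmn => edmdNode_injective hM δ (Complex.ofReal_injective hmn)⟩) ?_ ?_
    · refine (polyOf_degree_lt c).trans_le ?_
      simpa using hNM
    · intro z hz
      obtain ⟨m, hm, rfl⟩ := Finset.mem_map.mp hz
      exact h2 m hm
  refine hc (funext fun k => ?_)
  rw [← polyOf_coeff c k, hp]
  simp

theorem edmdGamma_eq : edmdGamma = (1 + Real.sqrt 2) ^ 2 := rfl

/-- The product of the growth factors of the coefficient sums with weights `ρ^k` and `1`. -/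
noncomputable def growthFactor (ρ : ℝ) : ℝ := (1 + Real.sqrt 2) * (ρ + Real.sqrt (1 + ρ ^ 2))

theorem one_le_growthFactor {ρ : ℝ} (hρ : 1 ≤ ρ) : 1 ≤ growthFactor ρ := by
  unfold growthFactor
  have h1 := Real.sqrt_nonneg 2
  have h2 := Real.sqrt_nonneg (1 + ρ ^ 2)
  nlinarith

/-- If the number of nodes is large, then the discrete mean square of a polynomial is at least half
of the continuous one.  As the discrete one is the quadratic form of `edmdH`, the linear system with
this matrix is stable: `sum_norm_coeff_le` enters once with the weights `1` and once with the
weights `ρ ^ k`. -/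
theorem sum_norm_mul_pow_le_of_large {ρ : ℝ} (hρ : 1 ≤ ρ) {N M : ℕ} {δ : ℝ} (hM : 0 < M)
    (hδ : 0 ≤ δ) (hδ' : δ ≤ 2 / (M : ℝ)) (hNM : 32 * N * edmdGamma ^ N ≤ M) (c : Fin N → ℂ)
    {W : ℝ} (hW0 : 0 ≤ W) (hW : ∀ k, ‖(edmdH M δ N).mulVec c k‖ ≤ W) :
    ∑ k, ‖c k‖ * ρ ^ (k : ℕ) ≤ 8 * growthFactor ρ ^ N * W := by
  have hM' : (0 : ℝ) < M := by exact_mod_cast hM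
  set A := ∑ k, ‖c k‖ with hA
  have hA0 : 0 ≤ A := Finset.sum_nonneg fun _ _ => norm_nonneg _
  set I := 1 / 2 * ∫ x in (-1 : ℝ)..1, ‖(polyOf c).eval (x : ℂ)‖ ^ 2 with hI
  set S := 1 / (M : ℝ) * ∑ m ∈ Finset.range M, ‖(polyOf c).eval (edmdNode M δ m : ℂ)‖ ^ 2 with hS
  have hI0 : 0 ≤ I := by
    rw [hI]
    exact mul_nonneg (by norm_num)
      (intervalIntegral.integral_nonneg (by norm_num) fun x _ => by positivity)
  have hcoeff : ∀ {s : ℝ}, 1 ≤ s → ∑ k, ‖c k‖ * s ^ (k : ℕ)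
      ≤ 2 * (s + Real.sqrt (1 + s ^ 2)) ^ N * Real.sqrt I := by
    intro s hs
    have h := sum_norm_coeff_le hs N (polyOf c) (polyOf_degree_lt c)
    rw [Finset.sum_range] at h
    simpa only [polyOf_coeff] using h
  have hA1 : A ≤ 2 * (1 + Real.sqrt 2) ^ N * Real.sqrt I := by
    have h := hcoeff le_rfl
    norm_num at h
    exact h
  have hA2 : A ^ 2 ≤ 4 * edmdGamma ^ N * I := by
    calc A ^ 2 ≤ (2 * (1 + Real.sqrt 2) ^ N * Real.sqrt I) ^ 2 := by gcongr
      _ = _ := by rw [mul_pow, Real.sq_sqrt hI0, edmdGamma_eq, mul_pow, pow_right_comm]; ring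
  have hRiem := (isVariationMajorant_normSq_polyOf c).abs_riemannSum_sub_integral_le hM hδ hδ'
  rw [← hA, ← hI, ← hS] at hRiem
  have hhalf : I ≤ 2 * S := by
    have h1 : (2 * N * A ^ 2 * 1 - 2 * N * A ^ 2 * (-1)) / M ≤ I / 2 := by
      rw [div_le_iff₀ hM']
      calc 2 * N * A ^ 2 * 1 - 2 * N * A ^ 2 * (-1) = 4 * N * A ^ 2 := by ring
        _ ≤ 4 * N * (4 * edmdGamma ^ N * I) := by gcongr
        _ = 32 * N * edmdGamma ^ N * (I / 2) := by ring
        _ ≤ M * (I / 2) := by gcongr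
        _ = _ := mul_comm _ _
    have := (abs_le.mp (hRiem.trans h1)).1
    linarith
  have hSle : S ≤ A * W := by
    have h := congrArg norm (sum_star_mul_edmdH_mulVec c M δ)
    rw [Complex.norm_real, Real.norm_eq_abs, ← hS] at h
    refine (le_abs_self S).trans (h ▸ (norm_sum_le _ _).trans ?_)
    rw [hA, Finset.sum_mul]
    refine Finset.sum_le_sum fun k _ => ?_
    rw [norm_mul, norm_star]
    gcongr
    exact hW k
  have hsqrt : Real.sqrt I ≤ 4 * (1 + Real.sqrt 2) ^ N * W := by
    have h1 : Real.sqrt I * Real.sqrt I ≤ 4 * (1 + Real.sqrt 2) ^ N * W * Real.sqrt I := by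
      rw [Real.mul_self_sqrt hI0]
      calc I ≤ 2 * (A * W) := by linarith
        _ ≤ 2 * (2 * (1 + Real.sqrt 2) ^ N * Real.sqrt I * W) := by gcongr
        _ = _ := by ring
    rcases (Real.sqrt_nonneg I).eq_or_lt with h | h
    · rw [← h]; positivity
    · exact le_of_mul_le_mul_right h1 h
  calc _ ≤ 2 * (ρ + Real.sqrt (1 + ρ ^ 2)) ^ N * Real.sqrt I := hcoeff hρ
    _ ≤ 2 * (ρ + Real.sqrt (1 + ρ ^ 2)) ^ N * (4 * (1 + Real.sqrt 2) ^ N * W) := by gcongr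
    _ = _ := by rw [growthFactor, mul_pow]; ring

/-- For fixed sizes, stability holds uniformly in the offset, by compactness. -/
theorem exists_sum_norm_mul_pow_le {ρ : ℝ} (hρ : 0 ≤ ρ) {N M : ℕ} (hM : 0 < M) (hNM : N ≤ M) :
    ∃ B : ℝ, ∀ (δ : ℝ), 0 ≤ δ → δ ≤ 2 / (M : ℝ) → ∀ (c : Fin N → ℂ) (W : ℝ), 0 ≤ W →
      (∀ k, ‖(edmdH M δ N).mulVec c k‖ ≤ W) → ∑ k, ‖c k‖ * ρ ^ (k : ℕ) ≤ B * W := by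
  have hH : Continuous fun δ : ℝ => edmdH M δ N := by
    refine continuous_matrix fun k l => ?_
    simp only [edmdH, edmdNode, Matrix.of_apply]
    fun_prop
  have hinv : Continuous fun δ : ℝ => (edmdH M δ N)⁻¹ := by
    simp only [Matrix.inv_def, Ring.inverse_eq_inv']
    exact (hH.matrix_det.inv₀ fun δ => (isUnit_det_edmdH hM hNM δ).ne_zero).smul hH.matrix_adjugate
  have hB : ∀ k l : Fin N, ∃ B : ℝ, ∀ δ ∈ Icc (0 : ℝ) (2 / M), ‖(edmdH M δ N)⁻¹ k l‖ ≤ B :=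
    fun k l => isCompact_Icc.exists_bound_of_continuousOn (hinv.matrix_elem k l).continuousOn
  choose B hB using hB
  refine ⟨∑ k, (∑ l, B k l) * ρ ^ (k : ℕ), fun δ hδ hδ' c W hW0 hW => ?_⟩
  have hc : c = (edmdH M δ N)⁻¹.mulVec ((edmdH M δ N).mulVec c) := by
    rw [Matrix.mulVec_mulVec, Matrix.nonsing_inv_mul _ (isUnit_det_edmdH hM hNM δ),
      Matrix.one_mulVec]
  rw [Finset.sum_mul]
  refine Finset.sum_le_sum fun k _ => ?_
  have h1 : ‖c k‖ ≤ (∑ l, B k l) * W := by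
    rw [hc, Matrix.mulVec, dotProduct, Finset.sum_mul]
    refine (norm_sum_le _ _).trans (Finset.sum_le_sum fun l _ => ?_)
    rw [norm_mul]
    have := hB k l δ ⟨hδ, hδ'⟩
    exact mul_le_mul this (hW l) (norm_nonneg _) ((norm_nonneg _).trans this)
  calc ‖c k‖ * ρ ^ (k : ℕ) ≤ (∑ l, B k l) * W * ρ ^ (k : ℕ) := by gcongr
    _ = _ := by ring

theorem le_of_sq_mul_pow_le {R : ℝ} (hR : 1 ≤ R) {N M : ℕ} (h : (N : ℝ) ^ 2 * R ^ N ≤ M) :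
    N ≤ M := by
  have h1 : (1 : ℝ) ≤ R ^ N := one_le_pow₀ hR
  have h2 : (N : ℝ) ≤ (N : ℝ) ^ 2 := by
    rcases Nat.eq_zero_or_pos N with rfl | hN
    · simp
    · have : (1 : ℝ) ≤ N := by exact_mod_cast hN
      nlinarith
  have : (N : ℝ) ≤ M := by nlinarith [sq_nonneg (N : ℝ)]
  exact_mod_cast this

/-- Stability of the linear system with matrix `edmdH` with one constant for all admissible
parameters.  The pairs `(N, M)` with `N ^ 2 * R ^ N ≤ M` that escape `sum_norm_mul_pow_le_of_large`
have `N < 32`, because `γ ≤ R`; so there are finitely many of them. -/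
theorem exists_stability_const {ρ R : ℝ} (hρ : 1 ≤ ρ) (hR : edmdGamma ≤ R) :
    ∃ K : ℝ, 0 < K ∧ ∀ (N M : ℕ) (δ : ℝ), 0 < M → 0 ≤ δ → δ ≤ 2 / (M : ℝ) →
      (N : ℝ) ^ 2 * R ^ N ≤ M → ∀ (c : Fin N → ℂ) (W : ℝ), 0 ≤ W →
      (∀ k, ‖(edmdH M δ N).mulVec c k‖ ≤ W) →
        ∑ k, ‖c k‖ * ρ ^ (k : ℕ) ≤ K * growthFactor ρ ^ N * W := by
  have hγ1 : 1 ≤ edmdGamma := by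
    rw [edmdGamma_eq]; exact one_le_pow₀ (by linarith [Real.sqrt_nonneg 2])
  have hex : ∀ N M : ℕ, ∃ B : ℝ, 0 < M → N ≤ M → ∀ (δ : ℝ), 0 ≤ δ → δ ≤ 2 / (M : ℝ) →
      ∀ (c : Fin N → ℂ) (W : ℝ), 0 ≤ W → (∀ k, ‖(edmdH M δ N).mulVec c k‖ ≤ W) →
        ∑ k, ‖c k‖ * ρ ^ (k : ℕ) ≤ B * W := by
    intro N M
    by_cases h : 0 < M ∧ N ≤ M
    · obtain ⟨B, hB⟩ := exists_sum_norm_mul_pow_le (zero_le_one.trans hρ) h.1 h.2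
      exact ⟨B, fun _ _ => hB⟩
    · exact ⟨0, fun h1 h2 => absurd ⟨h1, h2⟩ h⟩
  choose B hB using hex
  set M₀ := ⌈32 * 32 * edmdGamma ^ 32⌉₊ with hM₀
  set Btot := ∑ N ∈ Finset.range 32, ∑ M ∈ Finset.range M₀, |B N M|
  have hBtot : 0 ≤ Btot := Finset.sum_nonneg fun _ _ => Finset.sum_nonneg fun _ _ => abs_nonneg _
  refine ⟨8 + Btot, by positivity, fun N M δ hM hδ hδ' hNM c W hW0 hW => ?_⟩
  have hg : 1 ≤ growthFactor ρ ^ N := one_le_pow₀ (one_le_growthFactor hρ)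
  by_cases hlarge : 32 * N * edmdGamma ^ N ≤ M
  · refine (sum_norm_mul_pow_le_of_large hρ hM hδ hδ' hlarge c hW0 hW).trans ?_
    gcongr
    linarith
  · have hN : N < 32 := by
      by_contra! hN
      apply hlarge
      have hN' : (32 : ℝ) ≤ N := by exact_mod_cast hN
      calc 32 * N * edmdGamma ^ N ≤ N * N * R ^ N := by gcongr
        _ = (N : ℝ) ^ 2 * R ^ N := by ring
        _ ≤ M := hNM
    have hMlt : M < M₀ := by
      rw [hM₀, Nat.lt_ceil]
      refine (not_le.mp hlarge).trans_le ?_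
      have hN' : (N : ℝ) ≤ 32 := by exact_mod_cast hN.le
      gcongr
    have hle : |B N M| ≤ Btot := by
      refine le_trans ?_ (Finset.single_le_sum
        (f := fun N => ∑ M ∈ Finset.range M₀, |B N M|)
        (fun _ _ => Finset.sum_nonneg fun _ _ => abs_nonneg _) (Finset.mem_range.mpr hN))
      exact Finset.single_le_sum (f := fun M => |B N M|) (fun _ _ => abs_nonneg _)
        (Finset.mem_range.mpr hMlt)
    have hN2 := le_of_sq_mul_pow_le (hγ1.trans hR) hNM
    calc _ ≤ B N M * W := hB N M hM hN2 δ hδ hδ' c W hW0 hW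
      _ ≤ (8 + Btot) * 1 * W := by
        gcongr
        linarith [le_abs_self (B N M)]
      _ ≤ _ := by gcongr

/-! ### Consistency of the linear system -/

section Consistency

variable {d : ℕ} {T : ℝ → ℝ} {a b : Fin d → ℝ} {φ : Fin d → ℂ → ℂ} {r R : ℝ}

theorem norm_edmdH_sub_integral_le {N M : ℕ} (hM : 0 < M) {δ : ℝ} (hδ : 0 ≤ δ)
    (hδ' : δ ≤ 2 / (M : ℝ)) (k l : Fin N) :
    ‖edmdH M δ N k l - ((1 / 2 * ∫ x in (-1 : ℝ)..1, x ^ (k : ℕ) * x ^ (l : ℕ) : ℝ) : ℂ)‖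
      ≤ 4 * (N / M) := by
  have h := (IsVariationMajorant.id.pow_mul_pow (fun x hx => hx) k l).abs_riemannSum_sub_integral_le
    hM hδ hδ'
  simp only [id] at h
  rw [edmdH, Matrix.of_apply, ← Complex.ofReal_sub, Complex.norm_real, Real.norm_eq_abs]
  refine h.trans ?_
  rw [← mul_div_assoc]
  have h1 : ((k : ℕ) : ℝ) ≤ N := by exact_mod_cast k.2.le
  have h2 : ((l : ℕ) : ℝ) ≤ N := by exact_mod_cast l.2.le
  gcongr
  linarith

/-- The Taylor polynomial of the image of a monomial approximates the image on `[-1, 1]`. -/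
theorem norm_sub_sum_taylorCoeff_le {f : ℂ → ℂ} (hf : DifferentiableOn ℂ f (Metric.ball 0 R))
    (hR : 1 < R) {B q : ℝ} (hq : q < 1) (hB : ∀ n, ‖taylorCoeff f n‖ ≤ B * q ^ n)
    (N : ℕ) {y : ℝ} (hy : y ∈ Icc (-1 : ℝ) 1) :
    ‖f y - ∑ n ∈ Finset.range N, taylorCoeff f n * (y : ℂ) ^ n‖ ≤ B * q ^ N / (1 - q) := by
  have hy' : |y| ≤ 1 := abs_le.mpr hy
  have hmem : (y : ℂ) ∈ Metric.ball (0 : ℂ) R := by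
    rw [mem_ball_zero_iff, Complex.norm_real, Real.norm_eq_abs]; linarith
  have h := (hasSum_taylorCoeff hf hR hmem).tendsto_sum_nat
  have h2 := dist_le_of_le_geometric_of_tendsto q B hq (f := fun n =>
    ∑ i ∈ Finset.range n, taylorCoeff f i * (y : ℂ) ^ i) (fun n => ?_) h N
  · rwa [dist_comm, dist_eq_norm] at h2
  · rw [Finset.sum_range_succ, dist_self_add_right, norm_mul, norm_pow, Complex.norm_real,
      Real.norm_eq_abs]
    exact (mul_le_of_le_one_right (norm_nonneg _) (pow_le_one₀ (abs_nonneg _) hy')).trans (hB n)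

theorem sum_geometric_le {q : ℝ} (hq0 : 0 ≤ q) (hq : q < 1) (N : ℕ) :
    ∑ n ∈ Finset.range N, q ^ n ≤ 1 / (1 - q) := by
  rw [one_div, ← tsum_geometric_of_lt_one hq0 hq]
  exact (summable_geometric_of_lt_one hq0 hq).sum_le_tsum _ fun _ _ => by positivity

/-- Consistency: the Taylor coefficients of the image of `z^j` satisfy the linear system for the
`j`-th column of the EDMD matrix up to an error of the size of the Taylor remainder. -/
theorem exists_consistency_const (hT : IsAnalyticFullBranchMap T a b)
    (hφ : HasAnalyticInverseBranches T a b φ r R) {s : ℝ} (hs : 1 < s) (hsR : s < R) :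
    ∃ K : ℝ, 0 < K ∧ ∀ (N M : ℕ) (δ : ℝ), 0 < M → 0 ≤ δ → δ ≤ 2 / (M : ℝ) →
      (N : ℝ) ^ 2 * R ^ N ≤ M → ∀ k j : Fin N,
        ‖edmdG T M δ N k j - (edmdH M δ N).mulVec
          (fun n => taylorCoeff (transferMonomial φ j) n) k‖ ≤ K * r ^ (j : ℕ) * s⁻¹ ^ N := by
  obtain ⟨P, hP⟩ := hT.exists_isVariationMajorant
  obtain ⟨K, hK, hτ⟩ := hφ.exists_norm_taylorCoeff_le (one_pos.trans hs) hsR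
  set V := P 1 - P (-1) with hV
  have hV0 : 0 ≤ V := sub_nonneg.mpr (hP.monotoneOn (by norm_num) (by norm_num) (by norm_num))
  have hs0 : 0 < s := one_pos.trans hs
  have hq0 : 0 ≤ s⁻¹ := by positivity
  have hq1 : s⁻¹ < 1 := inv_lt_one_of_one_lt₀ hs
  have hq2 : 0 < 1 - s⁻¹ := by linarith
  refine ⟨V + 2 + 1 * (K / (1 - s⁻¹)) + 4 * (K / (1 - s⁻¹)), by positivity,
    fun N M δ hM hδ hδ' hNM k j => ?_⟩
  have hM' : (0 : ℝ) < M := by exact_mod_cast hM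
  have hN1 : (1 : ℝ) ≤ N := by exact_mod_cast (Nat.zero_le _).trans_lt k.2
  have hk : ((k : ℕ) : ℝ) ≤ N := by exact_mod_cast k.2.le
  have hj : ((j : ℕ) : ℝ) ≤ N := by exact_mod_cast j.2.le
  have hr1 : 1 ≤ r ^ (j : ℕ) := one_le_pow₀ hφ.one_lt.le
  have hr0 : 0 < r := one_pos.trans hφ.one_lt
  have hNM' : (N : ℝ) / M ≤ s⁻¹ ^ N := by
    rw [div_le_iff₀ hM', inv_pow, inv_mul_eq_div, le_div_iff₀ (by positivity)]
    calc (N : ℝ) * s ^ N ≤ (N : ℝ) ^ 2 * R ^ N := by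
          gcongr
          nlinarith
      _ ≤ M := hNM
  set f := transferMonomial φ j with hf
  have hfd : DifferentiableOn ℂ f (Metric.ball 0 R) := hφ.differentiableOn_transferOp (by fun_prop)
  have hR : 1 < R := hφ.one_lt.trans hφ.lt
  have hint : IntervalIntegrable (fun y : ℝ => (y : ℂ) ^ (k : ℕ) * f y)
      MeasureTheory.volume (-1) 1 := by
    refine ContinuousOn.intervalIntegrable ?_
    rw [uIcc_of_le (by norm_num)]
    exact (by fun_prop : Continuous fun y : ℝ => (y : ℂ) ^ (k : ℕ)).continuousOn.mul
      (hfd.continuousOn.comp Complex.continuous_ofReal.continuousOn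
        fun y hy => hφ.ofReal_mem_ball hy)
  -- The three errors: quadrature of the right-hand side, Taylor remainder, quadrature of the matrix.
  set E₁ := edmdG T M δ N k j
    - ((1 / 2 * ∫ x in (-1 : ℝ)..1, T x ^ (k : ℕ) * x ^ (j : ℕ) : ℝ) : ℂ) with hE₁
  set E₂ := 1 / 2 * ∫ y in (-1 : ℝ)..1, (y : ℂ) ^ (k : ℕ) *
    (f y - ∑ n ∈ Finset.range N, taylorCoeff f n * (y : ℂ) ^ n) with hE₂
  set E₃ := ∑ n : Fin N, (edmdH M δ N k n
    - ((1 / 2 * ∫ x in (-1 : ℝ)..1, x ^ (k : ℕ) * x ^ (n : ℕ) : ℝ) : ℂ)) * taylorCoeff f n with hE₃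
  have hsplit : edmdG T M δ N k j - (edmdH M δ N).mulVec (fun n => taylorCoeff f n) k
      = E₁ + E₂ - E₃ := by
    have h1 : E₂ = ((1 / 2 * ∫ x in (-1 : ℝ)..1, T x ^ (k : ℕ) * x ^ (j : ℕ) : ℝ) : ℂ)
        - ∑ n : Fin N, ((1 / 2 * ∫ x in (-1 : ℝ)..1, x ^ (k : ℕ) * x ^ (n : ℕ) : ℝ) : ℂ)
          * taylorCoeff f n := by
      have h2 : ∀ y : ℝ, (y : ℂ) ^ (k : ℕ) *
          (f y - ∑ n ∈ Finset.range N, taylorCoeff f n * (y : ℂ) ^ n)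
          = (y : ℂ) ^ (k : ℕ) * f y - ∑ n : Fin N,
            ((y ^ (k : ℕ) * y ^ (n : ℕ) : ℝ) : ℂ) * taylorCoeff f n := by
        intro y
        rw [mul_sub, Finset.mul_sum, Finset.sum_range]
        congr 1
        refine Finset.sum_congr rfl fun n _ => ?_
        push_cast; ring
      rw [hE₂]
      simp only [h2]
      rw [intervalIntegral.integral_sub hint (by apply Continuous.intervalIntegrable; fun_prop),
        intervalIntegral.integral_finsetSum
          (fun n _ => by apply Continuous.intervalIntegrable; fun_prop), mul_sub, Finset.mul_sum,
        ← hφ.integral_pow_mul_pow_eq hT k j]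
      congr 1
      · push_cast; rfl
      · refine Finset.sum_congr rfl fun n _ => ?_
        rw [intervalIntegral.integral_mul_const, intervalIntegral.integral_ofReal]
        push_cast; ring
    rw [h1, hE₁, hE₃, Matrix.mulVec, dotProduct]
    simp only [sub_mul, Finset.sum_sub_distrib]
    ring
  have hb₁ : ‖E₁‖ ≤ (V + 2) * (r ^ (j : ℕ) * s⁻¹ ^ N) := by
    have h := (hP.pow_mul_pow hT.mapsTo k j).abs_riemannSum_sub_integral_le hM hδ hδ'
    rw [hE₁, edmdG, Matrix.of_apply, ← Complex.ofReal_sub, Complex.norm_real, Real.norm_eq_abs]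
    refine h.trans ?_
    calc _ = (k * V + 2 * j) / M := by rw [hV]; ring
      _ ≤ (N * V + 2 * N) / M := by gcongr
      _ = (V + 2) * (1 * (N / M)) := by ring
      _ ≤ _ := by gcongr
  have hb₂ : ‖E₂‖ ≤ 1 * (K / (1 - s⁻¹)) * (r ^ (j : ℕ) * s⁻¹ ^ N) := by
    have h : ‖∫ y in (-1 : ℝ)..1, (y : ℂ) ^ (k : ℕ) *
        (f y - ∑ n ∈ Finset.range N, taylorCoeff f n * (y : ℂ) ^ n)‖
        ≤ K * r ^ (j : ℕ) * s⁻¹ ^ N / (1 - s⁻¹) * |1 - (-1)| := by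
      refine intervalIntegral.norm_integral_le_of_norm_le_const fun y hy => ?_
      rw [uIoc_of_le (by norm_num)] at hy
      have hy' := Ioc_subset_Icc_self hy
      rw [norm_mul, norm_pow, Complex.norm_real, Real.norm_eq_abs]
      exact (mul_le_of_le_one_left (norm_nonneg _)
        (pow_le_one₀ (abs_nonneg _) (abs_le.mpr hy'))).trans
        (norm_sub_sum_taylorCoeff_le hfd hR hq1 (hτ j) N hy')
    rw [hE₂, norm_mul]
    calc _ ≤ ‖(1 / 2 : ℂ)‖ * (K * r ^ (j : ℕ) * s⁻¹ ^ N / (1 - s⁻¹) * |1 - (-1)|) := by gcongr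
      _ = _ := by norm_num; ring
  have hb₃ : ‖E₃‖ ≤ 4 * (K / (1 - s⁻¹)) * (r ^ (j : ℕ) * s⁻¹ ^ N) := by
    calc ‖E₃‖ ≤ ∑ n : Fin N, 4 * s⁻¹ ^ N * (K * r ^ (j : ℕ) * s⁻¹ ^ (n : ℕ)) := by
          refine (norm_sum_le _ _).trans (Finset.sum_le_sum fun n _ => ?_)
          rw [norm_mul]
          gcongr
          · exact (norm_edmdH_sub_integral_le hM hδ hδ' k n).trans (by gcongr)
          · exact hτ j n
      _ = 4 * s⁻¹ ^ N * (K * r ^ (j : ℕ)) * ∑ n ∈ Finset.range N, s⁻¹ ^ n := by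
          rw [Finset.sum_range, Finset.mul_sum]
          refine Finset.sum_congr rfl fun n _ => by ring
      _ ≤ 4 * s⁻¹ ^ N * (K * r ^ (j : ℕ)) * (1 / (1 - s⁻¹)) := by
          gcongr
          exact sum_geometric_le hq0 hq1 N
      _ = _ := by ring
  rw [hsplit]
  calc ‖E₁ + E₂ - E₃‖ ≤ ‖E₁‖ + ‖E₂‖ + ‖E₃‖ :=
        (norm_sub_le _ _).trans (by gcongr; exact norm_add_le _ _)
    _ ≤ _ := by linarith

end Consistency

/-! ### Operators on `ℓ²` with summable matrix entries -/

section Operators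

theorem inner_unitVec_left (k : ℕ) (x : EllTwo) : inner ℂ (unitVec k) x = (x : ℕ → ℂ) k := by
  simp [unitVec, lp.inner_single_left]

theorem norm_unitVec (k : ℕ) : ‖unitVec k‖ = 1 := by
  simp [unitVec, lp.norm_single]

theorem inner_unitVec_unitVec (k l : ℕ) :
    inner ℂ (unitVec k) (unitVec l) = if k = l then (1 : ℂ) else 0 := by
  rw [inner_unitVec_left, unitVec]
  by_cases h : k = l
  · subst h; simp
  · simp [h]

theorem liftOp_comp {N : ℕ} (A B : Matrix (Fin N) (Fin N) ℂ) :
    liftOp A ∘L liftOp B = liftOp (A * B) := by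
  ext1 x
  simp only [liftOp, ContinuousLinearMap.comp_apply, _root_.sum_apply,
    _root_.smul_apply, InnerProductSpace.rankOne_apply, inner_sum, inner_smul_right,
    inner_unitVec_unitVec, Fin.val_inj, Matrix.mul_apply, Finset.sum_smul, Finset.smul_sum,
    smul_smul]
  refine Finset.sum_congr rfl fun k _ => ?_
  rw [Finset.sum_comm (γ := Fin N) (s := Finset.univ) (t := Finset.univ)
    (f := fun l m => (A k m * B m l * inner ℂ (unitVec l) x) • unitVec k)]
  refine Finset.sum_congr rfl fun m _ => ?_
  rw [Finset.sum_comm]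
  refine Finset.sum_congr rfl fun l _ => ?_
  simp only [mul_ite, mul_one, mul_zero, ite_smul, zero_smul, Finset.sum_ite_eq, Finset.mem_univ,
    if_true, mul_assoc]

/-- The operator `∑ a k l • ⟨e_l, ·⟩ e_k` with absolutely summable matrix entries. -/
noncomputable def matrixOp (c : ℕ → ℕ → ℂ) : EllTwo →L[ℂ] EllTwo :=
  ∑' x : ℕ × ℕ, c x.1 x.2 • InnerProductSpace.rankOne ℂ (unitVec x.1) (unitVec x.2)

theorem norm_smul_rankOne_unitVec (z : ℂ) (k l : ℕ) :
    ‖z • InnerProductSpace.rankOne ℂ (unitVec k) (unitVec l)‖ = ‖z‖ := by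
  rw [norm_smul, InnerProductSpace.norm_rankOne, norm_unitVec, norm_unitVec]; simp

variable {c : ℕ → ℕ → ℂ}

theorem summable_smul_rankOne (hc : Summable fun x : ℕ × ℕ => ‖c x.1 x.2‖) :
    Summable fun x : ℕ × ℕ =>
      c x.1 x.2 • InnerProductSpace.rankOne ℂ (unitVec x.1) (unitVec x.2) :=
  Summable.of_norm (by simpa only [norm_smul_rankOne_unitVec] using hc)

theorem matrixOp_apply_unitVec (hc : Summable fun x : ℕ × ℕ => ‖c x.1 x.2‖) (k l : ℕ) :
    (matrixOp c (unitVec l) : ℕ → ℂ) k = c k l := by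
  have h1 := (summable_smul_rankOne hc).hasSum
  have h2 := ((innerSL ℂ (unitVec k)).comp
    (ContinuousLinearMap.apply ℂ EllTwo (unitVec l))).hasSum h1
  rw [← inner_unitVec_left]
  refine h2.unique ?_
  have h3 := hasSum_ite_eq (k, l) (c k l)
  refine h3.congr_fun fun x => ?_
  simp only [ContinuousLinearMap.comp_apply, ContinuousLinearMap.apply_apply,
    _root_.smul_apply, InnerProductSpace.rankOne_apply, innerSL_apply_apply,
    inner_smul_right, inner_unitVec_unitVec]
  obtain ⟨i, j⟩ := x
  simp only [Prod.mk.injEq]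
  by_cases hi : i = k <;> by_cases hj : j = l
  · simp [hi, hj]
  · simp [hj]
  · simp [hi, Ne.symm hi]
  · simp [hj]

/-- The distance of a lifted matrix to an operator with summable entries is at most the sum of the
absolute entries of the difference, since the rank-one operators `⟨e_l, ·⟩ e_k` have norm `1`. -/
theorem norm_liftOp_sub_matrixOp_le (hc : Summable fun x : ℕ × ℕ => ‖c x.1 x.2‖) {N : ℕ}
    (A : Matrix (Fin N) (Fin N) ℂ) :
    ‖liftOp A - matrixOp c‖ ≤ ∑ l, ∑ k, ‖A k l - c k l‖
      + (∑' x : ℕ × ℕ, ‖c x.1 x.2‖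
        - ∑ x ∈ Finset.range N ×ˢ Finset.range N, ‖c x.1 x.2‖) := by
  set F := Finset.range N ×ˢ Finset.range N with hF
  set t := fun x : ℕ × ℕ => c x.1 x.2 • InnerProductSpace.rankOne ℂ (unitVec x.1) (unitVec x.2)
    with ht
  have hnorm : ∀ x, ‖t x‖ = ‖c x.1 x.2‖ := fun x => norm_smul_rankOne_unitVec _ _ _
  have h1 : ∑ x ∈ F, t x + ∑' x : {x // x ∉ F}, t x = matrixOp c :=
    (summable_smul_rankOne hc).sum_add_tsum_compl
  have h2 : ∑ x ∈ F, ‖c x.1 x.2‖ + ∑' x : {x // x ∉ F}, ‖t x‖ = ∑' x : ℕ × ℕ, ‖c x.1 x.2‖ := by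
    simp only [hnorm]
    exact hc.sum_add_tsum_compl
  have h3 : ‖∑' x : {x // x ∉ F}, t x‖ ≤ ∑' x : {x // x ∉ F}, ‖t x‖ :=
    norm_tsum_le_tsum_norm (by simp only [hnorm]; exact hc.subtype _)
  have h4 : ∑ x ∈ F, t x = liftOp (Matrix.of fun k l : Fin N => c k l) := by
    rw [hF, Finset.sum_product, Finset.sum_range, liftOp]
    refine Finset.sum_congr rfl fun k _ => ?_
    rw [Finset.sum_range]
    rfl
  have h5 : ‖liftOp A - ∑ x ∈ F, t x‖ ≤ ∑ l, ∑ k, ‖A k l - c k l‖ := by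
    rw [h4, liftOp, liftOp, ← Finset.sum_sub_distrib, Finset.sum_comm (γ := Fin N)]
    refine (norm_sum_le _ _).trans (Finset.sum_le_sum fun k _ => ?_)
    rw [← Finset.sum_sub_distrib]
    refine (norm_sum_le _ _).trans (Finset.sum_le_sum fun l _ => ?_)
    rw [← sub_smul, norm_smul_rankOne_unitVec, Matrix.of_apply]
  rw [← h1, ← sub_sub, ← h2, add_sub_cancel_left]
  exact (norm_sub_le _ _).trans (add_le_add h5 h3)

end Operators

/-! ### Convergence of the matrices -/

section Parameters

variable {r R ρ : ℝ}

theorem edmdGamma_pos : 0 < edmdGamma := by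
  unfold edmdGamma; positivity

/-- The growth factor is smaller than `γ ρ`, because `√(1 + ρ²) < √2 ρ` for `ρ > 1`. -/
theorem growthFactor_lt (hρ : 1 < ρ) : growthFactor ρ < edmdGamma * ρ := by
  have h2 : 0 < Real.sqrt 2 := by positivity
  have h : Real.sqrt (1 + ρ ^ 2) < Real.sqrt 2 * ρ := by
    rw [Real.sqrt_lt' (by positivity), mul_pow, Real.sq_sqrt (by norm_num)]
    nlinarith
  unfold growthFactor edmdGamma
  have h3 : 0 < 1 + Real.sqrt 2 := by positivity
  calc _ < (1 + Real.sqrt 2) * (ρ + Real.sqrt 2 * ρ) := by gcongr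
    _ = _ := by ring

/-- There is a radius `s` between `ρ` and `R` for which the growth factor times `s⁻¹` is exactly
`γ ρ / R = r / ρ`. -/
theorem exists_radius (hρ : 1 < ρ) (hρR : ρ < R) (hrρ : r < ρ)
    (hsq : edmdGamma * ρ ^ 2 = r * R) :
    ∃ s, ρ < s ∧ s < R ∧ growthFactor ρ * s⁻¹ = r / ρ ∧ ρ * s⁻¹ ≤ r / ρ := by
  have hγ := edmdGamma_pos
  have hg := growthFactor_lt hρ
  have hρ0 : 0 < ρ := by linarith
  have hR0 : 0 < R := by linarith
  have hgρ : ρ < growthFactor ρ := by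
    unfold growthFactor
    have h1 : 0 < Real.sqrt 2 := by positivity
    have h2 : 0 < Real.sqrt (1 + ρ ^ 2) := by positivity
    nlinarith [mul_pos h1 hρ0, mul_pos h1 h2]
  have hg0 : 0 < growthFactor ρ := by linarith
  have hr : r / ρ = edmdGamma * ρ / R := by
    rw [div_eq_div_iff hρ0.ne' hR0.ne']; linarith
  have hs : growthFactor ρ * (growthFactor ρ * R / (edmdGamma * ρ))⁻¹ = r / ρ := by
    rw [hr]; field_simp
  refine ⟨growthFactor ρ * R / (edmdGamma * ρ), ?_, ?_, hs, ?_⟩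
  · rw [lt_div_iff₀ (by positivity), show ρ * (edmdGamma * ρ) = edmdGamma * ρ ^ 2 by ring, hsq]
    gcongr
    linarith
  · rw [div_lt_iff₀ (by positivity), mul_comm R]
    gcongr
  · rw [← hs]
    gcongr

theorem rate_pow_eq (hr : 0 ≤ r) (hρ : 0 < ρ) (hR : 0 < R)
    (hsq : edmdGamma * ρ ^ 2 = r * R) (N : ℕ) :
    (edmdGamma * r / R) ^ ((N : ℝ) / 2) = (r / ρ) ^ N := by
  have hq : 0 ≤ r / ρ := by positivity
  have h : edmdGamma * r / R = (r / ρ) ^ 2 := by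
    rw [div_pow, div_eq_div_iff hR.ne' (by positivity)]
    calc edmdGamma * r * ρ ^ 2 = edmdGamma * ρ ^ 2 * r := by ring
      _ = _ := by rw [hsq]; ring
  rw [h, ← Real.rpow_natCast, ← Real.rpow_mul hq, ← Real.rpow_natCast]
  congr 1
  push_cast; ring

end Parameters

/-- The part of a double geometric series outside the square `[0, N)²`. -/
theorem tsum_sub_sum_geometric_le {p q : ℝ} (hp0 : 0 ≤ p) (hpq : p ≤ q) (hq : q < 1) (N : ℕ) :
    1 / (1 - p) * (1 / (1 - q))
      - (∑ k ∈ Finset.range N, p ^ k) * ∑ l ∈ Finset.range N, q ^ l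
      ≤ 2 / ((1 - p) * (1 - q)) * q ^ N := by
  have hp : p < 1 := hpq.trans_lt hq
  have hq0 : 0 ≤ q := hp0.trans hpq
  have hp' : 0 < 1 - p := by linarith
  have hq' : 0 < 1 - q := by linarith
  have e : ∀ {x : ℝ}, x < 1 → ∑ k ∈ Finset.range N, x ^ k = (1 - x ^ N) / (1 - x) := by
    intro x hx
    rw [geom_sum_eq hx.ne, ← neg_div_neg_eq]; simp
  rw [e hp, e hq, div_mul_div_comm, div_mul_div_comm, ← sub_div, div_mul_eq_mul_div]
  gcongr
  have h1 : p ^ N ≤ q ^ N := by gcongr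
  have h2 : 0 ≤ p ^ N * q ^ N := by positivity
  linarith

theorem corollary1 {d : ℕ} (T : ℝ → ℝ) (a b : Fin d → ℝ) (φ : Fin d → ℂ → ℂ) (r R ρ : ℝ)
    (hT : IsAnalyticFullBranchMap T a b)
    (hφ : HasAnalyticInverseBranches T a b φ r R)
    (hγ : r / R < 1 / edmdGamma)
    (hρ : ρ = Real.sqrt (r * R / edmdGamma)) :
    ∃ L : EllTwo →L[ℂ] EllTwo, IsTransferMatrix φ ρ L ∧
      ∃ C : ℝ, 0 < C ∧ ∀ (N M : ℕ) (δ : ℝ), 0 < M → 0 ≤ δ → δ ≤ 2 / (M : ℝ) →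
        (N : ℝ) ^ 2 * R ^ N ≤ (M : ℝ) →
          IsUnit (edmdH M δ N).det ∧
          ‖opV ρ N ∘L liftOp (edmdH M δ N)⁻¹ ∘L liftOp (edmdG T M δ N) ∘L opVInv ρ N - L‖
            ≤ C * (edmdGamma * r / R) ^ ((N : ℝ) / 2) := by
  have hr1 := hφ.one_lt
  have hr0 : 0 < r := one_pos.trans hr1
  have hR1 : 1 < R := hr1.trans hφ.lt
  have hR0 : 0 < R := one_pos.trans hR1
  have hγ0 := edmdGamma_pos
  have hγ1 : 1 ≤ edmdGamma := one_le_pow₀ (by linarith [Real.sqrt_nonneg 2])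
  have hγrR : edmdGamma * r < R := by
    rw [div_lt_div_iff₀ hR0 hγ0] at hγ; linarith
  have hρ2 : ρ ^ 2 = r * R / edmdGamma := by rw [hρ, Real.sq_sqrt (by positivity)]
  have hsq : edmdGamma * ρ ^ 2 = r * R := by rw [hρ2]; field_simp
  have hrρ : r < ρ := by
    rw [hρ, Real.lt_sqrt hr0.le, lt_div_iff₀ hγ0]
    nlinarith
  have hρ1 : 1 < ρ := hr1.trans hrρ
  have hρ0 : 0 < ρ := one_pos.trans hρ1
  have hρR : ρ < R := by
    refine lt_of_pow_lt_pow_left₀ 2 hR0.le ?_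
    nlinarith [hφ.lt, mul_le_mul_of_nonneg_right hγ1 (sq_nonneg ρ)]
  obtain ⟨s, hρs, hsR, hgs, hps⟩ := exists_radius hρ1 hρR hrρ hsq
  have hs1 : 1 < s := hρ1.trans hρs
  have hs0 : 0 < s := one_pos.trans hs1
  set q := r / ρ with hq
  have hq0 : 0 < q := by positivity
  have hq1 : q < 1 := (div_lt_one hρ0).mpr hrρ
  set p := ρ * s⁻¹ with hp
  have hp0 : 0 < p := by positivity
  have hp1 : p < 1 := hps.trans_lt hq1
  have hp' : 0 < 1 - p := by linarith
  have hq' : 0 < 1 - q := by linarith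
  obtain ⟨K, hK, hτ⟩ := hφ.exists_norm_taylorCoeff_le hs0 hsR
  obtain ⟨K₁, hK₁, hcons⟩ := exists_consistency_const hT hφ hs1 hsR
  obtain ⟨K₂, hK₂, hstab⟩ := exists_stability_const (R := R) hρ1.le (by nlinarith)
  set τ : ℕ → ℕ → ℂ := fun k l => taylorCoeff (transferMonomial φ l) k with hτdef
  set c : ℕ → ℕ → ℂ := fun k l => (ρ : ℂ) ^ k * τ k l * ((ρ : ℂ) ^ l)⁻¹ with hcdef
  have hcle : ∀ k l, ‖c k l‖ ≤ K * (p ^ k * q ^ l) := by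
    intro k l
    rw [hcdef, norm_mul, norm_mul, norm_inv, norm_pow, norm_pow, Complex.norm_real,
      Real.norm_eq_abs, abs_of_pos hρ0]
    calc _ ≤ ρ ^ k * (K * r ^ l * s⁻¹ ^ k) * (ρ ^ l)⁻¹ := by gcongr; exact hτ l k
      _ = _ := by rw [hp, hq, mul_pow, div_pow]; ring
  have hgp := summable_geometric_of_lt_one hp0.le hp1
  have hgq := summable_geometric_of_lt_one hq0.le hq1
  have hgeo : Summable fun x : ℕ × ℕ => p ^ x.1 * q ^ x.2 :=
    hgp.mul_of_nonneg hgq (fun _ => by positivity) fun _ => by positivity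
  have hgeoK := hgeo.mul_left K
  have hc : Summable fun x : ℕ × ℕ => ‖c x.1 x.2‖ :=
    Summable.of_nonneg_of_le (fun _ => norm_nonneg _) (fun x => hcle x.1 x.2) hgeoK
  refine ⟨matrixOp c, fun k l => ?_, K₂ * K₁ * (1 / (1 - q)) + K * (2 / ((1 - p) * (1 - q))),
    by positivity, fun N M δ hM hδ hδ' hNM => ?_⟩
  · rw [matrixOp_apply_unitVec hc]
    exact hφ.hasHardyInner_transferOp hρ0 hρR k l
  have hdet := isUnit_det_edmdH hM (le_of_sq_mul_pow_le hR1.le hNM) δ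
  refine ⟨hdet, ?_⟩
  rw [rate_pow_eq hr0.le hρ0 hR0 hsq, ← hq, opV, opVInv, liftOp_comp, liftOp_comp, liftOp_comp]
  refine (norm_liftOp_sub_matrixOp_le hc _).trans ?_
  rw [add_mul]
  refine add_le_add ?_ ?_
  -- Column by column, stability turns the consistency error into an error of the coefficients.
  · have hcol : ∀ l : Fin N, ∑ k : Fin N, ‖(Matrix.diagonal (fun n : Fin N => ((ρ ^ (n : ℕ) : ℝ) : ℂ))
        * ((edmdH M δ N)⁻¹ * (edmdG T M δ N *
          Matrix.diagonal fun n : Fin N => (((ρ ^ (n : ℕ))⁻¹ : ℝ) : ℂ)))) k l - c k l‖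
        ≤ K₂ * K₁ * q ^ N * q ^ (l : ℕ) := by
      intro l
      set e : Fin N → ℂ := (edmdH M δ N)⁻¹.mulVec
        ((fun k => edmdG T M δ N k l) - (edmdH M δ N).mulVec fun n => τ n l) with he
      have hHe : (edmdH M δ N).mulVec e
          = (fun k => edmdG T M δ N k l) - (edmdH M δ N).mulVec fun n => τ n l := by
        rw [he, Matrix.mulVec_mulVec, Matrix.mul_nonsing_inv _ hdet, Matrix.one_mulVec]
      have he' : ∀ k, e k = ((edmdH M δ N)⁻¹ * edmdG T M δ N) k l - τ k l := by
        intro k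
        rw [he, Matrix.mulVec_sub, Matrix.mulVec_mulVec, Matrix.nonsing_inv_mul _ hdet,
          Matrix.one_mulVec]
        rfl
      have hst := hstab N M δ hM hδ hδ' hNM e (K₁ * r ^ (l : ℕ) * s⁻¹ ^ N) (by positivity)
        (fun k => by rw [hHe]; exact hcons N M δ hM hδ hδ' hNM k l)
      have hentry : ∀ k : Fin N, ‖(Matrix.diagonal (fun n : Fin N => ((ρ ^ (n : ℕ) : ℝ) : ℂ))
        * ((edmdH M δ N)⁻¹ * (edmdG T M δ N *
          Matrix.diagonal fun n : Fin N => (((ρ ^ (n : ℕ))⁻¹ : ℝ) : ℂ)))) k l - c k l‖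
          = ‖e k‖ * ρ ^ (k : ℕ) * (ρ ^ (l : ℕ))⁻¹ := by
        intro k
        rw [Matrix.diagonal_mul, ← Matrix.mul_assoc, Matrix.mul_diagonal, he' k, hcdef]
        have : ∀ x y : ℂ, ((ρ ^ (k : ℕ) : ℝ) : ℂ) * (x * (((ρ ^ (l : ℕ))⁻¹ : ℝ) : ℂ))
            - (ρ : ℂ) ^ (k : ℕ) * y * ((ρ : ℂ) ^ (l : ℕ))⁻¹
            = (x - y) * ((ρ ^ (k : ℕ) : ℝ) : ℂ) * (((ρ ^ (l : ℕ))⁻¹ : ℝ) : ℂ) := by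
          intro x y; push_cast; ring
        rw [this, norm_mul, norm_mul, Complex.norm_real, Complex.norm_real,
          Real.norm_of_nonneg (by positivity), Real.norm_of_nonneg (by positivity)]
      simp only [hentry]
      rw [← Finset.sum_mul]
      calc _ ≤ K₂ * growthFactor ρ ^ N * (K₁ * r ^ (l : ℕ) * s⁻¹ ^ N) * (ρ ^ (l : ℕ))⁻¹ := by
            gcongr
        _ = K₂ * K₁ * (growthFactor ρ * s⁻¹) ^ N * (r / ρ) ^ (l : ℕ) := by
            rw [mul_pow, div_pow]; ring
        _ = _ := by rw [hgs]
    calc _ ≤ ∑ l : Fin N, K₂ * K₁ * q ^ N * q ^ (l : ℕ) := Finset.sum_le_sum fun l _ => hcol l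
      _ = K₂ * K₁ * q ^ N * ∑ l ∈ Finset.range N, q ^ l := by
        rw [Finset.sum_range, Finset.mul_sum]
      _ ≤ K₂ * K₁ * q ^ N * (1 / (1 - q)) := by
        gcongr
        exact sum_geometric_le hq0.le hq1 N
      _ = _ := by ring
  -- The entries of the limit operator outside the leading `N × N` block.
  · set F := Finset.range N ×ˢ Finset.range N with hF
    have h1 : ∑' x : ℕ × ℕ, ‖c x.1 x.2‖ - ∑ x ∈ F, ‖c x.1 x.2‖
        ≤ ∑' x : ℕ × ℕ, K * (p ^ x.1 * q ^ x.2) - ∑ x ∈ F, K * (p ^ x.1 * q ^ x.2) := by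
      have h := (hgeoK.sub hc).sum_le_tsum F fun x _ => sub_nonneg.mpr (hcle x.1 x.2)
      rw [Finset.sum_sub_distrib, hgeoK.tsum_sub hc] at h
      linarith
    refine h1.trans ?_
    rw [tsum_mul_left, ← Finset.mul_sum, ← mul_sub, hF, Finset.sum_product,
      ← hgp.tsum_mul_tsum hgq hgeo, tsum_geometric_of_lt_one hp0.le hp1,
      tsum_geometric_of_lt_one hq0.le hq1, ← Finset.sum_mul_sum, ← one_div, ← one_div, mul_assoc]
    gcongr
    exact tsum_sub_sum_geometric_le hp0.le hps hq1 N
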